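/- **Theorem (super-exponentially vanishing random perturbation).** Let $a(\lambda)=\sum_n a_n\lambda^n$ be a Laurent polynomial with complex coefficients, and let $T_N(a)=(a_{i-j})_{i,j=1}^N$ be the $N\times N$ Toeplitz matrix with symbol $a$. For an $N\times N$ matrix $M$ let $L_M=\frac1N\sum_{i=1}^N\delta_{\lambda_i(M)}$ be the empirical measure of its eigenvalues, counted with algebraic multiplicity. Let $N_+,N_-\ge 0$ be the smallest natural numbers with $a_n=0$ unless $-N_-\le n\le N_+$. For $z\in\mathbb C$ let $|\zeta_1(z)|\ge\dots\ge|\zeta_{N_++N_-}(z)|$ be the moduli of the roots, with multiplicity, of the polynomial $\zeta\mapsto\zeta^{N_-}(a(\zeta)-z)$ (roots lost to a drop of the degree are counted as roots at infinity), and put $|\zeta_0(z)|=\infty$, $|\zeta_{N_++N_-+1}(z)|=0$. Let $\Lambda(a)=\{z:|\zeta_{N_+}(z)|=|\zeta_{N_++1}(z)|\}$, which is a Lebesgue null set, and for $z\notin\Lambda(a)$ set $$\mathcal L_a(z)=\frac1{2\pi}\int_0^{2\pi}\log\bigl|a(\varrho e^{i\theta})-z\bigr|\,d\theta,\qquad |\zeta_{N_++1}(z)|<\varrho<|\zeta_{N_+}(z)|,\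 0<\varrho<\infty,$$ the value being independent of the choice of $\varrho$. Let $\delta_N>0$ satisfy $\frac1N\log(1/\delta_N)\to\infty$ as $N\to\infty$, and let $E_N$ be random complex $N\times N$ matrices with $\limsup_{N\to\infty} N^{-2}\,\mathbb E\|E_N\|_{\mathrm{HS}}^2<\infty$, where $\|\cdot\|_{\mathrm{HS}}$ is the Hilbert–Schmidt norm. Then $\mathcal L_a$ is locally integrable, there is a probability measure $\tilde\mu_a$ on $\mathbb C$ with $\tilde\mu_a=\frac1{2\pi}\Delta\mathcal L_a$ in the sense of distributions, $L_{T_N(a)}$ converges weakly to $\tilde\mu_a$, and $L_{T_N(a)+\delta_N E_N}$ converges weakly in probability to $\tilde\mu_a$: for every bounded continuous $f:\mathbb C\to\mathbb R$, $$\int f\,dL_{T_N(a)+\delta_NE_N}\longrightarrow\int f\,d\tilde\mu_a\quad\text{in probability as }N\to\infty.$$ So a super-exponentially small perturbation does not change the limiting spectral distribution. -/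

import Mathlib

open MeasureTheory Filter Topology
open scoped ENNReal NNReal LaurentPolynomial BoundedContinuousFunction Laplacian

noncomputable section

namespace ToeplitzLSD

/-- The value `a(w) = ∑ₙ aₙ wⁿ` of a Laurent polynomial at a point `w ≠ 0`. -/
def symbol (a : ℂ[T;T⁻¹]) (w : ℂ) : ℂ :=
  ∑ n ∈ a.coeff.support, a.coeff n * w ^ n

/-- The `N × N` Toeplitz matrix with symbol `a`; its `(i, j)` entry is `a_{i-j}`. -/
def toeplitz (a : ℂ[T;T⁻¹]) (N : ℕ) : Matrix (Fin N) (Fin N) ℂ :=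
  Matrix.of fun i j => a.coeff ((i : ℤ) - (j : ℤ))

/-- `N₊`: the smallest natural number such that `aₙ = 0` for all `n > N₊`. -/
def degPlus (a : ℂ[T;T⁻¹]) : ℕ := a.coeff.support.sup fun n => n.toNat

/-- `N₋`: the smallest natural number such that `aₙ = 0` for all `n < -N₋`. -/
def degMinus (a : ℂ[T;T⁻¹]) : ℕ := a.coeff.support.sup fun n => (-n).toNat

/-- The polynomial `ζ ↦ ζ ^ N₋ * (a(ζ) - z)`. -/
def shiftedPoly (a : ℂ[T;T⁻¹]) (z : ℂ) : Polynomial ℂ :=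
  (∑ k ∈ Finset.range (degPlus a + degMinus a + 1),
      Polynomial.C (a.coeff ((k : ℤ) - (degMinus a : ℤ))) * Polynomial.X ^ k)
    - Polynomial.C z * Polynomial.X ^ degMinus a

/-- The moduli, with multiplicity and in nonincreasing order, of the `N₊ + N₋` roots of
`shiftedPoly a z`. Roots lost to a drop of the degree (this can only happen if `N₊ = 0` and
`z = a₀`) are counted as roots at infinity. -/
def rootModuli (a : ℂ[T;T⁻¹]) (z : ℂ) : List ℝ≥0∞ :=
  ((shiftedPoly a z).roots.map (fun ζ => ENNReal.ofReal ‖ζ‖) +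
    Multiset.replicate (degPlus a + degMinus a - (shiftedPoly a z).roots.card) ⊤).sort
      (fun x y => y ≤ x)

/-- `|ζ_j(z)|` for `1 ≤ j ≤ N₊ + N₋`, with the conventions `|ζ_0(z)| = ∞` and `|ζ_j(z)| = 0` for
`j > N₊ + N₋`. -/
def zetaAbs (a : ℂ[T;T⁻¹]) (z : ℂ) (j : ℕ) : ℝ≥0∞ :=
  (⊤ :: rootModuli a z).getD j 0

/-- The interval of radii `ϱ` with `|ζ_{N₊+1}(z)| < ϱ < |ζ_{N₊}(z)|`. It is empty exactly for `z`
in the exceptional null set `Λ(a)`, where the two moduli are equal. -/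
def radii (a : ℂ[T;T⁻¹]) (z : ℂ) : Set ℝ :=
  {ϱ | 0 < ϱ ∧ zetaAbs a z (degPlus a + 1) < ENNReal.ofReal ϱ ∧
    ENNReal.ofReal ϱ < zetaAbs a z (degPlus a)}

open Classical in
/-- The function `𝓛_a(z) = (1/2π) ∫₀^{2π} log |a(ϱ e^{iθ}) - z| dθ`, for any radius `ϱ` in
`radii a z` (the value does not depend on which). On the null set where there is no such radius the
value is irrelevant, and set to `0`. -/
def logPot (a : ℂ[T;T⁻¹]) (z : ℂ) : ℝ :=
  if h : (radii a z).Nonempty then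
    (2 * Real.pi)⁻¹ * ∫ θ in (0 : ℝ)..(2 * Real.pi),
      Real.log ‖symbol a ((h.some : ℂ) * Complex.exp (Complex.I * (θ : ℂ))) - z‖
  else 0

/-- `μ = (1/2π) Δ L` in the sense of distributions on the plane. -/
def IsDistribLaplacian (μ : Measure ℂ) (L : ℂ → ℝ) : Prop :=
  LocallyIntegrable L volume ∧
    ∀ φ : ℂ → ℝ, ContDiff ℝ ((⊤ : ℕ∞) : WithTop ℕ∞) φ → HasCompactSupport φ →
      ∫ z, φ z ∂μ = (2 * Real.pi)⁻¹ * ∫ z, L z * (Δ φ) z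

/-- The empirical measure `(1/N) ∑ δ_{λ_i(A)}` of the eigenvalues of `A`, counted with algebraic
multiplicity. -/
def empMeasure {N : ℕ} (A : Matrix (Fin N) (Fin N) ℂ) : Measure ℂ :=
  (N : ℝ≥0∞)⁻¹ • (A.charpoly.roots.map Measure.dirac).sum

/-- The squared Hilbert-Schmidt norm. -/
def hsNormSq {N : ℕ} (A : Matrix (Fin N) (Fin N) ℂ) : ℝ :=
  ∑ i, ∑ j, ‖A i j‖ ^ 2

/-- Weak convergence of a sequence of measures. -/
def ConvWeakly (ν : ℕ → Measure ℂ) (μ : Measure ℂ) : Prop :=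
  ∀ f : ℂ →ᵇ ℝ, Tendsto (fun N => ∫ z, f z ∂(ν N)) atTop (𝓝 (∫ z, f z ∂μ))

/-- Weak convergence in probability of a sequence of random measures, the `N`-th one living on its
own probability space, to a deterministic measure. -/
def ConvWeaklyInProb {Ω : ℕ → Type*} [∀ N, MeasurableSpace (Ω N)] (P : ∀ N, Measure (Ω N))
    (ν : ∀ N, Ω N → Measure ℂ) (μ : Measure ℂ) : Prop :=
  ∀ f : ℂ →ᵇ ℝ, ∀ ε : ℝ, 0 < ε →
    Tendsto (fun N => P N {ω | ε ≤ |∫ z, f z ∂(ν N ω) - ∫ z, f z ∂μ|}) atTop (𝓝 0)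

end ToeplitzLSD

end

/-!
The eigenvalues enter only through the potentials `N⁻¹ log |det (T_N - z)|`, which are the
logarithmic potentials of the empirical measures. Everything rests on their pointwise limit for
almost every `z`, and on the stability of this limit under tiny perturbations.

**Limit of the determinants.** Put `m = degMinus a`, `n = degPlus a`, and let `p = shiftedPoly a z`.
If `p` has `m` simple roots inside and `n` simple roots outside a circle of radius `ϱ`, then
`det (T_N - z)` times a Vandermonde determinant equals, up to sign, `p_{m+n} ^ N` times a
generalized Vandermonde determinant of the roots with the exponents `0, …, m-1, m+N, …, m+N+n-1`
(`norm_det_bandMatrix_mul`). The latter is dominated by the product of the `N`-th powers of the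
large roots, so `N⁻¹ log |det (T_N - z)|` tends to `log |p_{m+n}| + ∑ log |ζ|`, the sum running over
the large roots (`tendsto_log_norm_det_bandMatrix`). By Jensen's formula this is `logPot a z`
(`circleAverage_log_symbol`).

**Almost every `z` is of this kind.** Critical values of the symbol form a null set, so for almost
every `z` the roots are simple; for `z ≠ a₀` they are nonzero and `m + n` in number. If two roots
`w`, `v` of equal modulus do not differ by a rotation leaving the symbol invariant, then `v` is
locally an analytic function of `w` and `v / w` is not constant, so `|v / w| = 1` holds on a null
set only; a Lindelöf argument covers all such pairs by countably many neighbourhoods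
(`volume_fst_badPairs`). For the remaining `z`, the roots of a given modulus form one orbit under
rotation by the `g`-th roots of unity, where `g` is the greatest common divisor of the exponents of
`a`. All these orbits have `g` elements and `g` divides `n`, so no orbit is split between the `n`
largest roots and the others (`IsGeneric.not_countP_straddle`).

**Perturbation.** If the rows of both matrices are bounded in the `ℓ¹` norm by a constant `K ≥ 1`,
then by multilinearity of the determinant the perturbation by a matrix with entries at most `η`
changes it by at most `N² K ^ N η`. If `η` is super-exponentially small this is negligible against
`|det (T_N - z)|`, which decays at most exponentially (`tendsto_log_norm_det_add`). For random
perturbations, Markov's inequality makes the entries of `E_N` at most `N²` outside an event of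
vanishing probability.

**From potentials to measures.** Since `log |z|` is a fundamental solution of the Laplacian up to
the factor `2π`, and the potentials of measures on a fixed disc are uniformly integrable on discs,
almost everywhere convergence of the potentials gives their convergence as distributions, hence that
of their Laplacians (`tendsto_average_of_tendsto_logAvg`). A compactness argument produces the limit
measure (`exists_isDistribLaplacian`), and as all the measures live on one disc, convergence against
test functions improves to weak convergence (`tendsto_integral_avgDirac`).
-/

noncomputable section

namespace ToeplitzLSD

/-! ### The fundamental solution of the Laplacian in the plane -/

lemma locallyIntegrable_log_norm : LocallyIntegrable (fun z : ℂ => Real.log ‖z‖) volume := by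
  rw [locallyIntegrable_iff]
  intro K hK
  obtain ⟨R, hR1, hKR⟩ : ∃ R : ℝ, 1 ≤ R ∧ K ⊆ Metric.closedBall 0 R := by
    obtain ⟨R, hR⟩ := hK.isBounded.subset_closedBall 0
    exact ⟨max R 1, le_max_right _ _,
      hR.trans (Metric.closedBall_subset_closedBall (le_max_left _ _))⟩
  -- In polar coordinates the integrand is `|r log r|`, which is bounded by `R²` for `r ≤ R`.
  refine IntegrableOn.mono_set ?_ hKR
  refine ⟨(Real.measurable_log.comp measurable_norm).aestronglyMeasurable, ?_⟩
  rw [hasFiniteIntegral_iff_enorm]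
  rw [← lintegral_indicator Metric.isClosed_closedBall.measurableSet,
    ← Complex.lintegral_comp_polarCoord_symm]
  calc _ ≤ ∫⁻ p in polarCoord.target,
        (Set.Ioc (0 : ℝ) R ×ˢ Set.Ioo (-Real.pi) Real.pi).indicator
          (fun _ => ENNReal.ofReal (R * R)) p := by
        refine setLIntegral_mono' polarCoord.open_target.measurableSet fun p hp => ?_
        simp only [polarCoord_target, Set.mem_prod, Set.mem_Ioi] at hp
        have hn : ‖Complex.polarCoord.symm p‖ = p.1 := by
          rw [Complex.norm_polarCoord_symm, abs_of_pos hp.1]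
        by_cases hpR : p.1 ≤ R
        · rw [Set.indicator_of_mem (by simpa [abs_of_pos hp.1] using hpR),
            Set.indicator_of_mem (by exact ⟨⟨hp.1, hpR⟩, hp.2⟩), hn, smul_eq_mul,
            ← ofReal_norm, ← ENNReal.ofReal_mul hp.1.le]
          refine ENNReal.ofReal_le_ofReal ?_
          rw [Real.norm_eq_abs]
          rcases le_total p.1 1 with h1 | h1
          · have := Real.abs_log_mul_self_lt p.1 hp.1 h1
            rw [abs_mul, abs_of_pos hp.1] at this
            nlinarith
          · rw [abs_of_nonneg (Real.log_nonneg h1)]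
            have := Real.log_le_self hp.1.le
            have := Real.log_nonneg h1
            nlinarith
        · rw [Set.indicator_of_notMem (by simpa [abs_of_pos hp.1] using hpR)]
          simp
    _ ≤ ∫⁻ p, (Set.Ioc (0 : ℝ) R ×ˢ Set.Ioo (-Real.pi) Real.pi).indicator
          (fun _ => ENNReal.ofReal (R * R)) p := setLIntegral_le_lintegral _ _
    _ < ⊤ := by
        rw [lintegral_indicator (measurableSet_Ioc.prod measurableSet_Ioo), setLIntegral_const,
          Measure.volume_eq_prod, Measure.prod_prod]
        simp only [Real.volume_Ioc, Real.volume_Ioo]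
        exact ENNReal.mul_lt_top ENNReal.ofReal_lt_top
          (ENNReal.mul_lt_top ENNReal.ofReal_lt_top ENNReal.ofReal_lt_top)

lemma laplacian_eq_fderiv_fderiv {φ : ℂ → ℝ} (hφ : ContDiff ℝ ((⊤ : ℕ∞) : WithTop ℕ∞) φ) (z : ℂ) :
    (Δ φ) z = fderiv ℝ (fun y => fderiv ℝ φ y 1) z 1 +
      fderiv ℝ (fun y => fderiv ℝ φ y Complex.I) z Complex.I := by
  have hd : DifferentiableAt ℝ (fderiv ℝ φ) z :=
    ((hφ.fderiv_right (m := ((⊤ : ℕ∞) : WithTop ℕ∞)) (by simp)).differentiable (by simp)) z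
  rw [InnerProductSpace.laplacian_eq_iteratedFDeriv_complexPlane]
  simp only [iteratedFDeriv_two_apply]
  rw [fderiv_clm_apply hd (by fun_prop), fderiv_clm_apply hd (by fun_prop)]
  simp

/-- The smoothing `½ log (‖z‖² + ε²)` of `log ‖z‖`. -/
def smoothLog (ε : ℝ) (z : ℂ) : ℝ := Real.log (‖z‖ ^ 2 + ε ^ 2) / 2

lemma hasFDerivAt_smoothLog {ε : ℝ} (hε : 0 < ε) (z : ℂ) :
    HasFDerivAt (smoothLog ε) ((‖z‖ ^ 2 + ε ^ 2)⁻¹ • (innerSL ℝ z)) z := by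
  have h0 : ‖z‖ ^ 2 + ε ^ 2 ≠ 0 := by positivity
  have h1 := (((hasStrictFDerivAt_norm_sq z).hasFDerivAt.add_const (ε ^ 2)).log h0).mul_const
    (1 / 2 : ℝ)
  have h2 : smoothLog ε = fun y => Real.log (‖y‖ ^ 2 + ε ^ 2) * (1 / 2) := by
    ext y; simp [smoothLog, div_eq_mul_inv]
  rw [h2]
  refine h1.congr_fderiv ?_
  ext v
  simp
  ring

/-- Two integrations by parts; `2 ε² / (‖z‖² + ε²)²` is the Laplacian of `smoothLog ε`. -/
lemma integral_smoothLog_mul_laplacian {ε : ℝ} (hε : 0 < ε) {φ : ℂ → ℝ}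
    (hφ : ContDiff ℝ ((⊤ : ℕ∞) : WithTop ℕ∞) φ) (hc : HasCompactSupport φ) :
    ∫ z, smoothLog ε z * (Δ φ) z = ∫ z, 2 * ε ^ 2 / (‖z‖ ^ 2 + ε ^ 2) ^ 2 * φ z := by
  have hq : ∀ z : ℂ, ‖z‖ ^ 2 + ε ^ 2 ≠ 0 := fun z => by positivity
  set h : ℂ → ℂ → ℝ := fun v z => (‖z‖ ^ 2 + ε ^ 2)⁻¹ * inner ℝ z v with hh
  have hg : ∀ v z, fderiv ℝ (smoothLog ε) z v = h v z := fun v z => by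
    rw [(hasFDerivAt_smoothLog hε z).fderiv]; simp [hh]
  have hgc : Continuous (smoothLog ε) :=
    continuous_iff_continuousAt.2 fun z => (hasFDerivAt_smoothLog hε z).continuousAt
  have hhd : ∀ v z, HasFDerivAt (h v) ((‖z‖ ^ 2 + ε ^ 2)⁻¹ • ((innerSL ℝ).flip v) -
      ((inner ℝ z v) * ((‖z‖ ^ 2 + ε ^ 2) ^ 2)⁻¹) • (2 • innerSL ℝ z)) z := fun v z => by
    have h1 := (hasDerivAt_inv (hq z)).comp_hasFDerivAt z
      ((hasStrictFDerivAt_norm_sq z).hasFDerivAt.add_const (ε ^ 2))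
    have h2 : HasFDerivAt (fun y : ℂ => inner ℝ y v) ((innerSL ℝ).flip v) z :=
      ((innerSL ℝ).flip v).hasFDerivAt
    have h3 := h1.mul h2
    refine h3.congr_fderiv ?_
    ext w; simp; ring
  have hhc : ∀ v, Continuous (h v) := fun v =>
    continuous_iff_continuousAt.2 fun z => (hhd v z).continuousAt
  have hh' : ∀ v z, fderiv ℝ (h v) z v = (‖z‖ ^ 2 + ε ^ 2)⁻¹ * inner ℝ v v -
      2 * (inner ℝ z v) ^ 2 / (‖z‖ ^ 2 + ε ^ 2) ^ 2 := fun v z => by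
    rw [(hhd v z).fderiv]
    simp only [sub_apply, smul_apply,
      ContinuousLinearMap.flip_apply, innerSL_apply_apply, smul_eq_mul, nsmul_eq_mul]
    ring
  have hh'c : ∀ v, Continuous fun z => fderiv ℝ (h v) z v := fun v => by
    simp_rw [hh']
    refine Continuous.sub (Continuous.mul (Continuous.inv₀ (by fun_prop) hq) (by fun_prop))
      (Continuous.div (by fun_prop) (by fun_prop) fun z => pow_ne_zero 2 (hq z))
  set d : ℂ → ℂ → ℝ := fun v z => fderiv ℝ φ z v with hd
  have hds : ∀ v, ContDiff ℝ ((⊤ : ℕ∞) : WithTop ℕ∞) (d v) := fun v =>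
    (hφ.fderiv_right (m := ((⊤ : ℕ∞) : WithTop ℕ∞)) (by simp)).clm_apply contDiff_const
  have hdc : ∀ v, HasCompactSupport (d v) := fun v => (hc.fderiv_apply (𝕜 := ℝ) v)
  have hd'c : ∀ v, HasCompactSupport fun z => fderiv ℝ (d v) z v :=
    fun v => ((hdc v).fderiv_apply (𝕜 := ℝ) v)
  have hd'cont : ∀ v, Continuous fun z => fderiv ℝ (d v) z v := fun v =>
    ((hds v).continuous_fderiv (by simp)).clm_apply continuous_const
  have key : ∀ v, ∫ z, smoothLog ε z * fderiv ℝ (d v) z v = ∫ z, fderiv ℝ (h v) z v * φ z := by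
    intro v
    rw [integral_mul_fderiv_eq_neg_fderiv_mul_of_integrable]
    · simp_rw [hg]
      have := integral_mul_fderiv_eq_neg_fderiv_mul_of_integrable (μ := (volume : Measure ℂ))
        (f := h v) (g := φ) (v := v)
        (((hh'c v).mul hφ.continuous).integrable_of_hasCompactSupport hc.mul_left)
        (((hhc v).mul (hds v).continuous).integrable_of_hasCompactSupport (hdc v).mul_left)
        (((hhc v).mul hφ.continuous).integrable_of_hasCompactSupport hc.mul_left)
        (fun z _ => (hhd v z).differentiableAt) (fun z _ => hφ.differentiable (by simp) z)
      rw [this, neg_neg]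
    · simp_rw [hg]
      exact ((hhc v).mul (hds v).continuous).integrable_of_hasCompactSupport (hdc v).mul_left
    · exact (hgc.mul (hd'cont v)).integrable_of_hasCompactSupport (hd'c v).mul_left
    · exact (hgc.mul (hds v).continuous).integrable_of_hasCompactSupport (hdc v).mul_left
    · exact fun z _ => (hasFDerivAt_smoothLog hε z).differentiableAt
    · exact fun z _ => (hds v).differentiable (by simp) z
  simp_rw [laplacian_eq_fderiv_fderiv hφ, mul_add]
  rw [integral_add, key 1, key Complex.I, ← integral_add]
  · refine integral_congr_ae (Eventually.of_forall fun z => ?_)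
    simp only [hh', ← add_mul]
    congr 1
    have h1 : inner ℝ z 1 = z.re := by simp [Complex.inner]
    have h2 : inner ℝ z Complex.I = z.im := by simp [Complex.inner]
    have h3 : ‖z‖ ^ 2 = z.re ^ 2 + z.im ^ 2 := by
      rw [← Complex.normSq_eq_norm_sq, Complex.normSq_apply]; ring
    have := hq z
    rw [h1, h2, real_inner_self_eq_norm_sq, real_inner_self_eq_norm_sq]
    rw [h3] at this ⊢
    simp only [norm_one, Complex.norm_I]
    field_simp
    ring
  · exact ((hh'c 1).mul hφ.continuous).integrable_of_hasCompactSupport hc.mul_left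
  · exact ((hh'c _).mul hφ.continuous).integrable_of_hasCompactSupport hc.mul_left
  · exact (hgc.mul (hd'cont 1)).integrable_of_hasCompactSupport (hd'c 1).mul_left
  · exact (hgc.mul (hd'cont _)).integrable_of_hasCompactSupport (hd'c _).mul_left

lemma integral_two_div_sq : ∫ y : ℂ, 2 / (‖y‖ ^ 2 + 1) ^ 2 = 2 * Real.pi := by
  rw [← Complex.integral_comp_polarCoord_symm]
  have h1 : ∫ r in Set.Ioi (0 : ℝ), r * (2 / (r ^ 2 + 1) ^ 2) = 1 := by
    have := integral_Ioi_of_hasDerivAt_of_nonneg' (a := 0) (l := 0)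
      (g := fun r : ℝ => -(r ^ 2 + 1)⁻¹) (g' := fun r => r * (2 / (r ^ 2 + 1) ^ 2))
      (fun r _ => by
        have h0 : r ^ 2 + 1 ≠ 0 := by positivity
        have := (((hasDerivAt_pow 2 r).add_const (1 : ℝ)).inv h0).neg
        refine this.congr_deriv ?_
        simp only [neg_div, neg_neg]
        norm_num
        ring)
      (fun r hr => by have : 0 < r := hr; positivity)
      (by
        rw [← neg_zero]
        refine Tendsto.neg (Tendsto.inv_tendsto_atTop ?_)
        exact tendsto_atTop_add_const_right _ _ (tendsto_pow_atTop (by norm_num)))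
    simpa using this
  have h2 := setIntegral_prod_mul (μ := (volume : Measure ℝ)) (ν := (volume : Measure ℝ))
    (fun r : ℝ => r * (2 / (r ^ 2 + 1) ^ 2)) (fun _ : ℝ => (1 : ℝ)) (Set.Ioi 0)
    (Set.Ioo (-Real.pi) Real.pi)
  rw [h1] at h2
  rw [polarCoord_target, Measure.volume_eq_prod]
  calc _ = _ := ?_
    _ = _ := h2
    _ = _ := ?_
  · refine setIntegral_congr_fun (measurableSet_Ioi.prod measurableSet_Ioo) fun p hp => ?_
    simp
  · simp
    rw [max_eq_left (by positivity)]; ring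

/-- The Laplacians of `smoothLog ε` are the dilates of a kernel of total mass `2π`, and so
approximate `2π` times the Dirac measure as `ε → 0`. -/
lemma tendsto_integral_laplacianKernel {φ : ℂ → ℝ} (hφ : Continuous φ)
    (hc : HasCompactSupport φ) {ε : ℕ → ℝ} (hε : ∀ k, 0 < ε k) (hε0 : Tendsto ε atTop (𝓝 0)) :
    Tendsto (fun k => ∫ z, 2 * ε k ^ 2 / (‖z‖ ^ 2 + ε k ^ 2) ^ 2 * φ z) atTop
      (𝓝 (2 * Real.pi * φ 0)) := by
  -- The integral of a nonintegrable function would be `0`, and this one is `2π`.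
  have hint : Integrable fun y : ℂ => 2 / (‖y‖ ^ 2 + 1) ^ 2 := by
    refine not_imp_comm.1 integral_undef ?_
    rw [integral_two_div_sq]; positivity
  have hscale : ∀ k, ∫ z, 2 * ε k ^ 2 / (‖z‖ ^ 2 + ε k ^ 2) ^ 2 * φ z =
      ∫ y : ℂ, 2 / (‖y‖ ^ 2 + 1) ^ 2 * φ (ε k • y) := fun k => by
    have h := Measure.integral_comp_smul (volume : Measure ℂ)
      (fun z : ℂ => 2 * ε k ^ 2 / (‖z‖ ^ 2 + ε k ^ 2) ^ 2 * φ z) (ε k)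
    have hk := hε k
    rw [Complex.finrank_real_complex, abs_of_pos (by positivity), smul_eq_mul,
      eq_inv_mul_iff_mul_eq₀ (by positivity), ← integral_const_mul] at h
    rw [← h]
    refine integral_congr_ae (Eventually.of_forall fun y => ?_)
    simp only [norm_smul, Real.norm_eq_abs, abs_of_pos hk, mul_pow]
    have : ‖y‖ ^ 2 + 1 ≠ 0 := by positivity
    rw [show ε k ^ 2 * ‖y‖ ^ 2 + ε k ^ 2 = ε k ^ 2 * (‖y‖ ^ 2 + 1) by ring]
    field_simp
  simp_rw [hscale]
  obtain ⟨M, hM⟩ := hc.exists_bound_of_continuous hφ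
  rw [← integral_two_div_sq, ← integral_mul_const]
  refine tendsto_integral_of_dominated_convergence (fun y => 2 / (‖y‖ ^ 2 + 1) ^ 2 * M)
    (fun k => hint.aestronglyMeasurable.mul
      (hφ.comp (continuous_const_smul _)).aestronglyMeasurable) (hint.mul_const _)
    (fun k => Eventually.of_forall fun y => ?_) (Eventually.of_forall fun y => ?_)
  · rw [norm_mul, Real.norm_of_nonneg (by positivity)]
    exact mul_le_mul_of_nonneg_left (hM _) (by positivity)
  · refine Tendsto.const_mul _ ((hφ.tendsto 0).comp ?_)
    simpa using hε0.smul_const y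

lemma laplacian_continuous {φ : ℂ → ℝ} (hφ : ContDiff ℝ ((⊤ : ℕ∞) : WithTop ℕ∞) φ) :
    Continuous (Δ φ) := by
  have : (Δ φ) = _ := funext (laplacian_eq_fderiv_fderiv hφ)
  rw [this]
  have hds : ∀ v : ℂ, ContDiff ℝ ((⊤ : ℕ∞) : WithTop ℕ∞) (fun z => fderiv ℝ φ z v) := fun v =>
    (hφ.fderiv_right (m := ((⊤ : ℕ∞) : WithTop ℕ∞)) (by simp)).clm_apply contDiff_const
  exact (((hds _).continuous_fderiv (by simp)).clm_apply continuous_const).add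
    (((hds _).continuous_fderiv (by simp)).clm_apply continuous_const)

lemma laplacian_hasCompactSupport {φ : ℂ → ℝ} (hφ : ContDiff ℝ ((⊤ : ℕ∞) : WithTop ℕ∞) φ)
    (hc : HasCompactSupport φ) : HasCompactSupport (Δ φ) := by
  have : (Δ φ) = _ := funext (laplacian_eq_fderiv_fderiv hφ)
  rw [this]
  exact ((hc.fderiv_apply (𝕜 := ℝ) 1).fderiv_apply (𝕜 := ℝ) 1).add
    ((hc.fderiv_apply (𝕜 := ℝ) Complex.I).fderiv_apply (𝕜 := ℝ) Complex.I)

/-- `(2π)⁻¹ log ‖z‖` is a fundamental solution of the Laplacian: pass to the limit `ε → 0` in the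
formula for `smoothLog ε`. -/
theorem integral_log_norm_mul_laplacian {φ : ℂ → ℝ}
    (hφ : ContDiff ℝ ((⊤ : ℕ∞) : WithTop ℕ∞) φ) (hc : HasCompactSupport φ) :
    ∫ z, Real.log ‖z‖ * (Δ φ) z = 2 * Real.pi * φ 0 := by
  set ε : ℕ → ℝ := fun k => 1 / ((k : ℝ) + 1) with hεdef
  have hε : ∀ k, 0 < ε k := fun k => by positivity
  have hε1 : ∀ k, ε k ≤ 1 := fun k => by
    rw [hεdef]; simp only; rw [div_le_one (by positivity)]; simp
  have hε0 : Tendsto ε atTop (𝓝 0) := tendsto_one_div_add_atTop_nhds_zero_nat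
  have h1 := tendsto_integral_laplacianKernel hφ.continuous hc hε hε0
  simp_rw [← integral_smoothLog_mul_laplacian (hε _) hφ hc] at h1
  refine tendsto_nhds_unique ?_ h1
  have hLc := laplacian_continuous hφ
  have hLs := laplacian_hasCompactSupport hφ hc
  have hz0 : ∀ᵐ z : ℂ, z ≠ 0 := by simp [ae_iff]
  have hlb : Continuous fun z : ℂ => Real.log (‖z‖ ^ 2 + 1) :=
    Continuous.log (by fun_prop) fun z => by positivity
  -- Domination: `log ‖z‖ ≤ smoothLog ε z ≤ ½ log (‖z‖² + 1)` for `ε ≤ 1`.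
  refine tendsto_integral_of_dominated_convergence
    (fun z => ‖Real.log ‖z‖ * (Δ φ) z‖ + ‖Real.log (‖z‖ ^ 2 + 1) * (Δ φ) z‖) (fun k => ?_) ?_
    (fun k => ?_) ?_
  · exact ((continuous_iff_continuousAt.2 fun z =>
      (hasFDerivAt_smoothLog (hε k) z).continuousAt).mul hLc).aestronglyMeasurable
  · refine Integrable.add (Integrable.norm ?_)
      ((hlb.mul hLc).integrable_of_hasCompactSupport hLs.mul_left).norm
    have := locallyIntegrable_log_norm.integrable_smul_right_of_hasCompactSupport hLc hLs
    simpa [smul_eq_mul] using this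
  · filter_upwards [hz0] with z hz
    have hzp : 0 < ‖z‖ := norm_pos_iff.2 hz
    have hεk := hε k
    have hεk1 := hε1 k
    simp only [norm_mul, ← add_mul]
    refine mul_le_mul_of_nonneg_right ?_ (norm_nonneg _)
    have hlow : Real.log ‖z‖ ≤ smoothLog (ε k) z := by
      have : Real.log (‖z‖ ^ 2) ≤ Real.log (‖z‖ ^ 2 + ε k ^ 2) :=
        Real.log_le_log (by positivity) (by nlinarith)
      rw [Real.log_pow] at this
      rw [smoothLog]; push_cast at this; linarith
    have hup : smoothLog (ε k) z ≤ Real.log (‖z‖ ^ 2 + 1) / 2 := by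
      rw [smoothLog]
      have := Real.log_le_log (x := ‖z‖ ^ 2 + ε k ^ 2) (y := ‖z‖ ^ 2 + 1) (by positivity)
        (by nlinarith)
      linarith
    have hpos : 0 ≤ Real.log (‖z‖ ^ 2 + 1) := Real.log_nonneg (by nlinarith)
    simp only [Real.norm_eq_abs]
    rw [abs_of_nonneg hpos]
    refine abs_le.2 ⟨?_, ?_⟩
    · have := neg_abs_le (Real.log ‖z‖); linarith
    · have := abs_nonneg (Real.log ‖z‖); linarith
  · filter_upwards [hz0] with z hz
    have hzp : 0 < ‖z‖ := norm_pos_iff.2 hz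
    refine Tendsto.mul_const _ ?_
    have h2 : Tendsto (fun k => ‖z‖ ^ 2 + ε k ^ 2) atTop (𝓝 (‖z‖ ^ 2)) := by
      simpa using (hε0.pow 2).const_add (‖z‖ ^ 2)
    have h3 := (h2.log (by positivity)).div_const 2
    rw [Real.log_pow] at h3
    simpa [smoothLog] using h3

theorem integral_log_norm_sub_mul_laplacian {φ : ℂ → ℝ}
    (hφ : ContDiff ℝ ((⊤ : ℕ∞) : WithTop ℕ∞) φ) (hc : HasCompactSupport φ) (w : ℂ) :
    ∫ z, Real.log ‖z - w‖ * (Δ φ) z = 2 * Real.pi * φ w := by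
  have hφ' : ContDiff ℝ ((⊤ : ℕ∞) : WithTop ℕ∞) fun z => φ (z + w) :=
    hφ.comp (contDiff_id.add contDiff_const)
  have hc' : HasCompactSupport fun z => φ (z + w) := hc.comp_homeomorph (Homeomorph.addRight w)
  have h := integral_log_norm_mul_laplacian hφ' hc'
  rw [← integral_sub_right_eq_self _ w, zero_add] at h
  rw [← h]
  refine integral_congr_ae (Eventually.of_forall fun z => ?_)
  simp only
  congr 1
  rw [laplacian_eq_fderiv_fderiv hφ, laplacian_eq_fderiv_fderiv hφ']
  have e : ∀ v : ℂ, (fun y => fderiv ℝ (fun z => φ (z + w)) y v) =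
      fun y => (fun x => fderiv ℝ φ x v) (y + w) := fun v => by
    ext y; rw [fderiv_comp_add_right]
  have e2 : ∀ (f : ℂ → ℝ) v, fderiv ℝ (fun y => f (y + w)) (z - w) v = fderiv ℝ f z v :=
    fun f v => by rw [fderiv_comp_add_right, sub_add_cancel]
  rw [e, e, e2 (fun x => fderiv ℝ φ x 1), e2 (fun x => fderiv ℝ φ x Complex.I)]

/-! ### Convergence of measures from convergence of their logarithmic potentials -/

lemma setLIntegral_log_norm_sub (A : Set ℂ) (hA : MeasurableSet A) (w : ℂ) :
    ∫⁻ z in A, ‖Real.log ‖z - w‖‖ₑ = ∫⁻ z in (· + w) ⁻¹' A, ‖Real.log ‖z‖‖ₑ := by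
  rw [← lintegral_indicator hA, ← lintegral_indicator (measurable_add_const w hA),
    ← lintegral_add_right_eq_self (A.indicator fun z => ‖Real.log ‖z - w‖‖ₑ) w]
  refine lintegral_congr fun z => ?_
  by_cases hz : z + w ∈ A
  · rw [Set.indicator_of_mem hz, Set.indicator_of_mem (by exact hz), add_sub_cancel_right]
  · rw [Set.indicator_of_notMem hz, Set.indicator_of_notMem (by exact hz)]

lemma preimage_add_subset_closedBall {A : Set ℂ} {ρ R : ℝ} (hA : A ⊆ Metric.closedBall 0 ρ) {w : ℂ}
    (hw : ‖w‖ ≤ R) : (· + w) ⁻¹' A ⊆ Metric.closedBall 0 (ρ + R) := by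
  intro z hz
  have h1 : ‖z + w‖ ≤ ρ := by simpa using hA hz
  have h2 : ‖z‖ ≤ ‖z + w‖ + ‖w‖ := by simpa using norm_sub_le (z + w) w
  simpa using by linarith

/-- Uniform absolute continuity of the integrals of `log ‖z - w‖`, for `w` in a disc. The functions
are translates of a single locally integrable one. -/
lemma exists_setLIntegral_log_norm_sub_le (ρ R : ℝ) {ε : ℝ} (hε : 0 < ε) :
    ∃ δ : ℝ, 0 < δ ∧ ∀ w : ℂ, ‖w‖ ≤ R → ∀ A, MeasurableSet A → A ⊆ Metric.closedBall 0 ρ →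
      volume A ≤ ENNReal.ofReal δ → ∫⁻ z in A, ‖Real.log ‖z - w‖‖ₑ ≤ ENNReal.ofReal ε := by
  have hL : MemLp (fun z : ℂ => Real.log ‖z‖) 1
      (volume.restrict (Metric.closedBall 0 (ρ + R))) :=
    memLp_one_iff_integrable.2
      (locallyIntegrable_log_norm.integrableOn_isCompact (isCompact_closedBall _ _))
  obtain ⟨δ, hδ, h⟩ := hL.eLpNorm_indicator_le le_rfl ENNReal.one_ne_top hε
  refine ⟨δ, hδ, fun w hw A hA hAρ hAδ => ?_⟩
  have hA' : MeasurableSet ((· + w) ⁻¹' A) := measurable_add_const w hA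
  have hsub := preimage_add_subset_closedBall hAρ hw
  have := h _ hA' (by
    rw [Measure.restrict_apply hA', Set.inter_eq_left.2 hsub, measure_preimage_add_right]
    exact hAδ)
  rw [eLpNorm_indicator_eq_eLpNorm_restrict hA', Measure.restrict_restrict hA',
    Set.inter_eq_left.2 hsub, eLpNorm_one_eq_lintegral_enorm] at this
  rwa [setLIntegral_log_norm_sub A hA]

lemma exists_setLIntegral_log_norm_sub_bound (ρ R : ℝ) :
    ∃ C : ℝ≥0, ∀ w : ℂ, ‖w‖ ≤ R →
      ∫⁻ z in Metric.closedBall (0 : ℂ) ρ, ‖Real.log ‖z - w‖‖ₑ ≤ C := by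
  have hL : IntegrableOn (fun z : ℂ => Real.log ‖z‖) (Metric.closedBall 0 (ρ + R)) :=
    locallyIntegrable_log_norm.integrableOn_isCompact (isCompact_closedBall _ _)
  refine ⟨(∫⁻ z in Metric.closedBall (0 : ℂ) (ρ + R), ‖Real.log ‖z‖‖ₑ).toNNReal, fun w hw => ?_⟩
  rw [setLIntegral_log_norm_sub _ Metric.isClosed_closedBall.measurableSet,
    ENNReal.coe_toNNReal hL.2.ne]
  exact lintegral_mono_set (preimage_add_subset_closedBall subset_rfl hw)

/-- The averaged logarithmic potential `N⁻¹ ∑ log |z - w|` of a multiset of points `w`. -/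
def logAvg (N : ℕ) (s : Multiset ℂ) (z : ℂ) : ℝ :=
  (N : ℝ)⁻¹ * (s.map fun w => Real.log ‖z - w‖).sum

lemma measurable_sum_log (s : Multiset ℂ) :
    Measurable fun z : ℂ => (s.map fun w => Real.log ‖z - w‖).sum := by
  induction s using Multiset.induction_on with
  | empty => simp
  | cons a s ih =>
    simp only [Multiset.map_cons, Multiset.sum_cons]
    exact (Real.measurable_log.comp (by fun_prop)).add ih

lemma measurable_logAvg (N : ℕ) (s : Multiset ℂ) : Measurable (logAvg N s) :=
  (measurable_sum_log s).const_mul _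

lemma setLIntegral_logAvg_le {N : ℕ} {s : Multiset ℂ} (hs : s.card ≤ N) (A : Set ℂ) {B : ℝ≥0∞}
    (hB : ∀ w ∈ s, ∫⁻ z in A, ‖Real.log ‖z - w‖‖ₑ ≤ B) :
    ∫⁻ z in A, ‖logAvg N s z‖ₑ ≤ B := by
  have key : ∫⁻ z in A, ‖(s.map fun w => Real.log ‖z - w‖).sum‖ₑ ≤ s.card * B := by
    clear hs
    induction s using Multiset.induction_on with
    | empty => simp
    | cons a s ih =>
      simp only [Multiset.map_cons, Multiset.sum_cons, Multiset.card_cons]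
      calc _ ≤ ∫⁻ z in A, (‖Real.log ‖z - a‖‖ₑ + ‖(s.map fun w => Real.log ‖z - w‖).sum‖ₑ) :=
            lintegral_mono fun z => enorm_add_le _ _
        _ = (∫⁻ z in A, ‖Real.log ‖z - a‖‖ₑ) +
              ∫⁻ z in A, ‖(s.map fun w => Real.log ‖z - w‖).sum‖ₑ :=
            lintegral_add_right _ (measurable_sum_log s).enorm
        _ ≤ B + s.card * B := add_le_add (hB a (Multiset.mem_cons_self a s))
            (ih fun w hw => hB w (Multiset.mem_cons_of_mem hw))
        _ = _ := by push_cast; ring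
  rcases Nat.eq_zero_or_pos N with rfl | hN
  · simp [logAvg]
  have hN' : (N : ℝ) ≠ 0 := by positivity
  simp only [logAvg, enorm_mul]
  rw [lintegral_const_mul _ (measurable_sum_log s).enorm, enorm_inv hN', Real.enorm_natCast]
  calc _ ≤ (N : ℝ≥0∞)⁻¹ * (N * B) := by
        refine mul_le_mul_right (key.trans ?_) _
        gcongr
    _ = B := by
        rw [← mul_assoc, ENNReal.inv_mul_cancel (by exact_mod_cast hN.ne') (by simp), one_mul]

/-- The averaged potentials of points in a fixed disc are uniformly integrable on every disc. -/
lemma uniformIntegrable_logAvg {s : ℕ → Multiset ℂ} {R : ℝ} (hs : ∀ N, (s N).card ≤ N)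
    (hR : ∀ N, ∀ w ∈ s N, ‖w‖ ≤ R) (ρ : ℝ) :
    UniformIntegrable (fun N => logAvg N (s N)) 1
      (volume.restrict (Metric.closedBall (0 : ℂ) ρ)) := by
  refine ⟨fun N => (measurable_logAvg N _).aestronglyMeasurable, fun ε hε => ?_, ?_⟩
  · obtain ⟨δ, hδ, h⟩ := exists_setLIntegral_log_norm_sub_le ρ R hε
    refine ⟨δ, hδ, fun N A hA hAδ => ?_⟩
    rw [eLpNorm_indicator_eq_eLpNorm_restrict hA, Measure.restrict_restrict hA,
      eLpNorm_one_eq_lintegral_enorm]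
    rw [Measure.restrict_apply hA] at hAδ
    exact setLIntegral_logAvg_le (hs N) _ fun w hw => h w (hR N w hw) _
      (hA.inter Metric.isClosed_closedBall.measurableSet) Set.inter_subset_right hAδ
  · obtain ⟨C, hC⟩ := exists_setLIntegral_log_norm_sub_bound ρ R
    refine ⟨C, fun N => ?_⟩
    rw [eLpNorm_one_eq_lintegral_enorm]
    exact setLIntegral_logAvg_le (hs N) _ fun w hw => hC w (hR N w hw)

lemma integrable_log_norm_sub_mul {ψ : ℂ → ℝ} (hψ : Continuous ψ) (hc : HasCompactSupport ψ)
    (w : ℂ) : Integrable fun z => Real.log ‖z - w‖ * ψ z := by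
  have h := locallyIntegrable_log_norm.integrable_smul_right_of_hasCompactSupport
    (g := fun z => ψ (z + w)) (hψ.comp (continuous_add_const w))
    (hc.comp_homeomorph (Homeomorph.addRight w))
  simpa [smul_eq_mul] using h.comp_sub_right w

lemma integral_logAvg_mul_laplacian {φ : ℂ → ℝ}
    (hφ : ContDiff ℝ ((⊤ : ℕ∞) : WithTop ℕ∞) φ) (hc : HasCompactSupport φ) (N : ℕ)
    (s : Multiset ℂ) :
    Integrable (fun z => logAvg N s z * (Δ φ) z) ∧
    ∫ z, logAvg N s z * (Δ φ) z = 2 * Real.pi * ((N : ℝ)⁻¹ * (s.map φ).sum) := by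
  have key : Integrable (fun z => (s.map fun w => Real.log ‖z - w‖).sum * (Δ φ) z) ∧
      ∫ z, (s.map fun w => Real.log ‖z - w‖).sum * (Δ φ) z = 2 * Real.pi * (s.map φ).sum := by
    induction s using Multiset.induction_on with
    | empty => simp
    | cons a s ih =>
      simp only [Multiset.map_cons, Multiset.sum_cons, add_mul]
      have h := integrable_log_norm_sub_mul (laplacian_continuous hφ)
        (laplacian_hasCompactSupport hφ hc) a
      refine ⟨h.add ih.1, ?_⟩
      rw [integral_add h ih.1, ih.2, integral_log_norm_sub_mul_laplacian hφ hc]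
      ring
  simp only [logAvg, mul_assoc]
  refine ⟨key.1.const_mul _, ?_⟩
  rw [integral_const_mul, key.2]
  ring

/-- If the averaged potentials of points in a fixed disc converge almost everywhere, they converge
in `L¹` on discs by Vitali's theorem, and so do their distributional Laplacians as distributions. -/
theorem tendsto_average_of_tendsto_logAvg {s : ℕ → Multiset ℂ} {R : ℝ} {u : ℂ → ℝ}
    (hs : ∀ᶠ N in atTop, (s N).card = N) (hR : ∀ᶠ N in atTop, ∀ w ∈ s N, ‖w‖ ≤ R)
    (hu : ∀ᵐ z, Tendsto (fun N => logAvg N (s N) z) atTop (𝓝 (u z))) :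
    LocallyIntegrable u volume ∧
    ∀ φ : ℂ → ℝ, ContDiff ℝ ((⊤ : ℕ∞) : WithTop ℕ∞) φ → HasCompactSupport φ →
      Tendsto (fun N : ℕ => (N : ℝ)⁻¹ * ((s N).map φ).sum) atTop
        (𝓝 ((2 * Real.pi)⁻¹ * ∫ z, u z * (Δ φ) z)) := by
  classical
  -- Discard the finitely many multisets violating the hypotheses.
  set s' : ℕ → Multiset ℂ := fun N =>
    if (s N).card = N ∧ ∀ w ∈ s N, ‖w‖ ≤ R then s N else 0 with hs'
  have hss' : ∀ᶠ N in atTop, s' N = s N := by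
    filter_upwards [hs, hR] with N h1 h2
    simp only [hs', if_pos (And.intro h1 h2)]
  have hcard : ∀ N, (s' N).card ≤ N := fun N => by
    simp only [hs']; split_ifs with h
    · exact h.1.le
    · simp
  have hR' : ∀ N, ∀ w ∈ s' N, ‖w‖ ≤ R := fun N => by
    simp only [hs']; split_ifs with h
    · exact h.2
    · simp
  have hu' : ∀ᵐ z, Tendsto (fun N => logAvg N (s' N) z) atTop (𝓝 (u z)) := by
    filter_upwards [hu] with z hz
    refine hz.congr' ?_
    filter_upwards [hss'] with N hN
    rw [hN]
  have hUI := fun ρ => uniformIntegrable_logAvg hcard hR' ρ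
  have hint : ∀ ρ, IntegrableOn u (Metric.closedBall (0 : ℂ) ρ) := fun ρ =>
    (hUI ρ).integrable_of_ae_tendsto (ae_restrict_of_ae hu')
  refine ⟨?_, fun φ hφ hc => ?_⟩
  · rw [locallyIntegrable_iff]
    intro K hK
    obtain ⟨ρ, hρ⟩ := hK.isBounded.subset_closedBall (0 : ℂ)
    exact (hint ρ).mono_set hρ
  have hLc := laplacian_continuous hφ
  have hLs := laplacian_hasCompactSupport hφ hc
  obtain ⟨M, hM⟩ := hLs.exists_bound_of_continuous hLc
  obtain ⟨ρ, hρ⟩ := hLs.isBounded.subset_closedBall (0 : ℂ)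
  set ν := volume.restrict (Metric.closedBall (0 : ℂ) ρ) with hν
  have : IsFiniteMeasure ν := ⟨by
    rw [hν, Measure.restrict_apply_univ]; exact measure_closedBall_lt_top⟩
  have hball : ∀ f : ℂ → ℝ, ∫ z, f z * (Δ φ) z ∂ν = ∫ z, f z * (Δ φ) z := fun f => by
    refine setIntegral_eq_integral_of_forall_compl_eq_zero fun z hz => ?_
    rw [image_eq_zero_of_notMem_tsupport fun h => hz (hρ h), mul_zero]
  have hconv : Tendsto (fun N => eLpNorm (logAvg N (s' N) - u) 1 ν) atTop (𝓝 0) :=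
    tendsto_Lp_finite_of_tendsto_ae le_rfl ENNReal.one_ne_top (hUI ρ).1
      (memLp_one_iff_integrable.2 (hint ρ)) (hUI ρ).2.1 (ae_restrict_of_ae hu')
  have hlim : Tendsto (fun N => ∫ z, logAvg N (s' N) z * (Δ φ) z ∂ν) atTop
      (𝓝 (∫ z, u z * (Δ φ) z ∂ν)) := by
    refine tendsto_integral_of_L1' _
      ((hint ρ).aestronglyMeasurable.mul hLc.aestronglyMeasurable)
      (Eventually.of_forall fun N => (integral_logAvg_mul_laplacian hφ hc N (s' N)).1.restrict) ?_
    have h0 : Tendsto (fun N => ENNReal.ofReal M * eLpNorm (logAvg N (s' N) - u) 1 ν) atTop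
        (𝓝 0) := by
      simpa using ENNReal.Tendsto.const_mul hconv (Or.inr ENNReal.ofReal_ne_top)
    refine tendsto_of_tendsto_of_tendsto_of_le_of_le tendsto_const_nhds h0 (fun _ => zero_le)
      fun N => ?_
    refine eLpNorm_le_mul_eLpNorm_of_ae_le_mul (Eventually.of_forall fun z => ?_) 1
    simp only [Pi.sub_apply, Pi.mul_apply, ← sub_mul, norm_mul]
    rw [mul_comm]
    exact mul_le_mul_of_nonneg_right (hM z) (norm_nonneg _)
  simp_rw [hball, (integral_logAvg_mul_laplacian hφ hc _ _).2] at hlim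
  have := hlim.const_mul (2 * Real.pi)⁻¹
  refine this.congr' ?_
  filter_upwards [hss'] with N hN
  rw [hN, inv_mul_cancel_left₀ (by positivity)]

/-- The measure `N⁻¹ ∑ δ_w` of a multiset of points `w`. -/
def avgDirac (N : ℕ) (s : Multiset ℂ) : Measure ℂ :=
  (N : ℝ≥0∞)⁻¹ • (s.map Measure.dirac).sum

lemma integral_avgDirac (N : ℕ) (s : Multiset ℂ) (f : ℂ → ℝ) :
    ∫ z, f z ∂(avgDirac N s) = (N : ℝ)⁻¹ * (s.map f).sum := by
  have key : Integrable f (s.map Measure.dirac).sum ∧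
      ∫ z, f z ∂(s.map Measure.dirac).sum = (s.map f).sum := by
    induction s using Multiset.induction_on with
    | empty => simp
    | cons a s ih =>
      simp only [Multiset.map_cons, Multiset.sum_cons]
      have h : Integrable f (Measure.dirac a) := integrable_dirac (by simp)
      refine ⟨h.add_measure ih.1, ?_⟩
      rw [integral_add_measure h ih.1, ih.2, integral_dirac]
  rw [avgDirac, integral_smul_measure, key.2]
  simp

lemma avgDirac_apply (N : ℕ) (s : Multiset ℂ) {A : Set ℂ} (hA : ∀ w ∈ s, w ∈ A) :
    avgDirac N s A = (N : ℝ≥0∞)⁻¹ * s.card ∧ avgDirac N s Aᶜ = 0 := by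
  have key : (s.map Measure.dirac).sum A = s.card ∧ (s.map Measure.dirac).sum Aᶜ = 0 := by
    induction s using Multiset.induction_on with
    | empty => simp
    | cons a s ih =>
      have ha : a ∈ A := hA a (Multiset.mem_cons_self a s)
      have := ih fun w hw => hA w (Multiset.mem_cons_of_mem hw)
      simp only [Multiset.map_cons, Multiset.sum_cons, Measure.add_apply, this.1, this.2,
        Multiset.card_cons, Measure.dirac_apply]
      simp [ha, add_comm]
  simp [avgDirac, key.1, key.2]

/-- The limit of the potentials has `2π` times a probability measure as its distributional
Laplacian. This measure is obtained as a limit along an ultrafilter of the empirical measures in the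
weakly compact set of measures on the disc. -/
theorem exists_isDistribLaplacian {s : ℕ → Multiset ℂ} {R : ℝ} {u : ℂ → ℝ}
    (hs : ∀ᶠ N in atTop, (s N).card = N) (hR : ∀ᶠ N in atTop, ∀ w ∈ s N, ‖w‖ ≤ R)
    (hu : ∀ᵐ z, Tendsto (fun N => logAvg N (s N) z) atTop (𝓝 (u z))) :
    ∃ μ : Measure ℂ, IsProbabilityMeasure μ ∧ μ (Metric.closedBall 0 R)ᶜ = 0 ∧
      IsDistribLaplacian μ u := by
  obtain ⟨hloc, hlim⟩ := tendsto_average_of_tendsto_logAvg hs hR hu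
  have hmass : ∀ N, 0 < N → (s N).card = N → avgDirac N (s N) Set.univ = 1 := fun N hN hc => by
    rw [(avgDirac_apply N (s N) fun w _ => Set.mem_univ w).1, hc,
      ENNReal.inv_mul_cancel (by exact_mod_cast hN.ne') (by simp)]
  classical
  -- Finite measures of mass at most `1` on the disc form a weakly compact set; for the finitely
  -- many exceptional `N` the value `0` is used.
  set L : ℕ → FiniteMeasure ℂ := fun N =>
    if h : 0 < N ∧ (s N).card = N then ⟨avgDirac N (s N), ⟨by rw [hmass N h.1 h.2]; simp⟩⟩ else 0
    with hL
  have hLN : ∀ᶠ N in atTop, ((L N : FiniteMeasure ℂ) : Measure ℂ) = avgDirac N (s N) := by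
    filter_upwards [hs, eventually_gt_atTop 0] with N h1 h2
    rw [show L N = _ from dif_pos (And.intro h2 h1)]
    rfl
  set F : Ultrafilter ℕ := Ultrafilter.of atTop with hF
  have hFle : (F : Filter ℕ) ≤ atTop := Ultrafilter.of_le _
  have hcomp := isCompact_setOfPred_finiteMeasure_le_of_isCompact 1
    (isCompact_closedBall (0 : ℂ) R)
  obtain ⟨ν, ⟨-, hνR⟩, hν⟩ := hcomp.ultrafilter_le_nhds (F.map L) (by
    rw [le_principal_iff, Ultrafilter.mem_coe, Ultrafilter.mem_map]
    refine hFle ?_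
    filter_upwards [hs, hR, hLN, eventually_gt_atTop 0] with N h1 h2 h3 h4
    refine ⟨?_, ?_⟩
    · have : ((L N).mass : ℝ≥0∞) ≤ (1 : ℝ≥0) := by
        rw [FiniteMeasure.ennreal_mass, h3, hmass N h4 h1]; simp
      exact_mod_cast this
    · rw [FiniteMeasure.null_iff_toMeasure_null, h3]
      exact (avgDirac_apply N (s N) fun w hw => by simpa using h2 w hw).2)
  have hνt : Tendsto L F (𝓝 ν) := hν
  have hmassν : ν.mass = 1 := by
    refine tendsto_nhds_unique (FiniteMeasure.continuous_mass.continuousAt.tendsto.comp hνt)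
      (tendsto_const_nhds.congr' ?_)
    refine hFle ?_
    filter_upwards [hs, hLN, eventually_gt_atTop 0] with N h1 h3 h4
    have : ((L N).mass : ℝ≥0∞) = (1 : ℝ≥0) := by
      rw [FiniteMeasure.ennreal_mass, h3, hmass N h4 h1]; simp
    exact_mod_cast this.symm
  refine ⟨ν, ⟨?_⟩, ?_, hloc, fun φ hφ hc => ?_⟩
  · rw [← FiniteMeasure.ennreal_mass, hmassν]; simp
  · rwa [← FiniteMeasure.null_iff_toMeasure_null]
  · obtain ⟨M, hM⟩ := hc.exists_bound_of_continuous hφ.continuous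
    have h1 := FiniteMeasure.tendsto_iff_forall_integral_tendsto.1 hνt
      (BoundedContinuousFunction.ofNormedAddCommGroup φ hφ.continuous M hM)
    refine tendsto_nhds_unique h1 (((hlim φ hφ hc).mono_left hFle).congr' ?_)
    refine hFle ?_
    filter_upwards [hLN] with N h3
    rw [h3, integral_avgDirac]
    rfl

/-- Weak convergence follows from convergence against test functions, because all the measures are
carried by one disc, on which a bounded continuous function is a uniform limit of test functions. -/
theorem tendsto_integral_avgDirac {s : ℕ → Multiset ℂ} {R : ℝ} {u : ℂ → ℝ}
    (hs : ∀ᶠ N in atTop, (s N).card = N) (hR : ∀ᶠ N in atTop, ∀ w ∈ s N, ‖w‖ ≤ R)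
    (hu : ∀ᵐ z, Tendsto (fun N => logAvg N (s N) z) atTop (𝓝 (u z)))
    {μ : Measure ℂ} [IsProbabilityMeasure μ] (hμR : μ (Metric.closedBall 0 R)ᶜ = 0)
    (hμ : IsDistribLaplacian μ u) (f : ℂ →ᵇ ℝ) :
    Tendsto (fun N => ∫ z, f z ∂(avgDirac N (s N))) atTop (𝓝 (∫ z, f z ∂μ)) := by
  obtain ⟨-, hlim⟩ := tendsto_average_of_tendsto_logAvg hs hR hu
  simp_rw [integral_avgDirac]
  rw [Metric.tendsto_atTop']
  intro ε hε
  -- Cut `f` off outside the disc and approximate the result uniformly by a test function `g`.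
  let χ : ContDiffBump (0 : ℂ) := ⟨|R| + 1, |R| + 2, by positivity, by linarith⟩
  obtain ⟨g, hg, hgf, hgs⟩ := Continuous.exists_contDiff_approx (E := ℂ) (F := ℝ)
    (f := fun z => f z * χ z) (ε := fun _ => ε / 4) ⊤ (f.continuous.mul χ.continuous)
    continuous_const (fun _ => by positivity)
  have hgc : HasCompactSupport g :=
    (χ.hasCompactSupport.mul_left (f := fun z => f z)).mono hgs
  have hclose : ∀ z, ‖z‖ ≤ R → |g z - f z| ≤ ε / 4 := fun z hz => by
    have h1 : χ z = 1 := χ.one_of_mem_closedBall (by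
      simp only [mem_closedBall_zero_iff]
      show ‖z‖ ≤ |R| + 1
      have := le_abs_self R; linarith)
    have := hgf z
    rw [h1, mul_one, Real.dist_eq] at this
    exact this.le
  have hg1 := hlim g hg hgc
  rw [← hμ.2 g hg hgc, Metric.tendsto_atTop'] at hg1
  obtain ⟨N₀, hN₀⟩ := hg1 (ε / 4) (by positivity)
  have hsum : ∀ᶠ N : ℕ in atTop,
      |(N : ℝ)⁻¹ * ((s N).map g).sum - (N : ℝ)⁻¹ * ((s N).map f).sum| ≤ ε / 4 := by
    filter_upwards [hs, hR, eventually_gt_atTop 0] with N h1 h2 h3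
    have key : ∀ t : Multiset ℂ, (∀ w ∈ t, ‖w‖ ≤ R) →
        |(t.map g).sum - (t.map f).sum| ≤ t.card * (ε / 4) := by
      intro t
      induction t using Multiset.induction_on with
      | empty => simp
      | cons a t ih =>
        intro ht
        have ha := hclose a (ht a (Multiset.mem_cons_self a t))
        have hb := ih fun w hw => ht w (Multiset.mem_cons_of_mem hw)
        simp only [Multiset.map_cons, Multiset.sum_cons, Multiset.card_cons]
        calc _ = |(g a - f a) + ((t.map g).sum - (t.map f).sum)| := by ring_nf
          _ ≤ _ := abs_add_le _ _
          _ ≤ ε / 4 + t.card * (ε / 4) := add_le_add ha hb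
          _ = _ := by push_cast; ring
    have := key (s N) h2
    rw [h1] at this
    rw [← mul_sub, abs_mul, abs_of_nonneg (by positivity), inv_mul_le_iff₀ (by positivity)]
    exact this
  have hμg : |∫ z, g z ∂μ - ∫ z, f z ∂μ| ≤ ε / 4 := by
    rw [← integral_sub (hg.continuous.integrable_of_hasCompactSupport hgc) (f.integrable μ)]
    have h := norm_integral_le_of_norm_le_const (μ := μ) (f := fun z => g z - f z) (C := ε / 4) (by
      have : ∀ᵐ z ∂μ, z ∈ Metric.closedBall (0 : ℂ) R := by
        rw [ae_iff]; exact hμR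
      filter_upwards [this] with z hz
      exact hclose z (by simpa using hz))
    simpa using h
  obtain ⟨N₁, hN₁⟩ := eventually_atTop.1 hsum
  refine ⟨max N₀ N₁, fun N hN => ?_⟩
  have e1 := hN₀ N (lt_of_le_of_lt (le_max_left _ _) hN)
  have e2 := hN₁ N ((le_max_right N₀ N₁).trans hN.le)
  rw [Real.dist_eq] at e1 ⊢
  rw [abs_le] at e2 hμg
  rw [abs_lt] at e1 ⊢
  constructor <;> linarith

/-! ### Determinants of banded Toeplitz matrices -/

section

open Matrix Polynomial

/-- The `N × N` banded Toeplitz matrix with entries `p_{m + j - i}`. -/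
def bandMatrix (p : ℂ[X]) (m N : ℕ) : Matrix (Fin N) (Fin N) ℂ :=
  Matrix.of fun i j => (p * X ^ (i : ℕ)).coeff (m + j)

/-- The exponents `m, …, m + N - 1`, followed by the others in `0, …, m + N + n - 1`. -/
def bandExp (m n N : ℕ) : Fin N ⊕ (Fin m ⊕ Fin n) → ℕ :=
  Sum.elim (fun i => m + i) (Sum.elim (fun j => j) fun j => m + N + j)

/-- The exponents `m + n, …, m + n + N - 1`, followed by `0, …, m + n - 1`. -/
def topExp (m n N : ℕ) : Fin N ⊕ (Fin m ⊕ Fin n) → ℕ :=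
  Sum.elim (fun i => m + n + i) (Sum.elim (fun j => j) fun j => m + j)

/-- An injective family of exponents below `m + n + N` is an enumeration of all of them. -/
lemma exists_equiv_of_exp {m n N : ℕ} (e : Fin N ⊕ (Fin m ⊕ Fin n) → ℕ)
    (he : Function.Injective e) (hlt : ∀ c, e c < m + n + N) :
    ∃ E : Fin N ⊕ (Fin m ⊕ Fin n) ≃ Fin (m + n + N), ∀ c, (E c : ℕ) = e c := by
  have hinj : Function.Injective fun c => (⟨e c, hlt c⟩ : Fin (m + n + N)) := fun a b h =>
    he (by simpa using h)
  refine ⟨Equiv.ofBijective _ ((Fintype.bijective_iff_injective_and_card _).2 ⟨hinj, ?_⟩),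
    fun c => rfl⟩
  simp; ring

lemma exists_equiv_bandExp (m n N : ℕ) :
    ∃ E : Fin N ⊕ (Fin m ⊕ Fin n) ≃ Fin (m + n + N), ∀ c, (E c : ℕ) = bandExp m n N c := by
  refine exists_equiv_of_exp _ ?_ ?_
  · rintro (a | a | a) (b | b | b) h <;> simp [bandExp] at h ⊢ <;> omega
  · rintro (a | a | a) <;> simp [bandExp] <;> omega

lemma exists_equiv_topExp (m n N : ℕ) :
    ∃ E : Fin N ⊕ (Fin m ⊕ Fin n) ≃ Fin (m + n + N), ∀ c, (E c : ℕ) = topExp m n N c := by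
  refine exists_equiv_of_exp _ ?_ ?_
  · rintro (a | a | a) (b | b | b) h <;> simp [topExp] at h ⊢ <;> omega
  · rintro (a | a | a) <;> simp [topExp] <;> omega

/-- The generalized Vandermonde matrix with entries `ζ_q ^ (e k)`. -/
def expMatrix {ι κ : Type*} (e : κ → ℕ) (ζ : ι → ℂ) : Matrix κ ι ℂ :=
  Matrix.of fun k q => ζ q ^ e k

/-- Widom's determinant identity, up to sign. The rows of `bandMatrix p m N` are the middle parts of
the coefficient vectors of `p`, `X p`, …, `X ^ (N - 1) p`, and these vectors are annihilated by the
columns `(ζ ^ k)ₖ` for every root `ζ` of `p`. -/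
theorem norm_det_bandMatrix_mul {m n : ℕ} {p : ℂ[X]} (hp : p.natDegree ≤ m + n)
    {ζ : Fin m ⊕ Fin n → ℂ} (hζ : ∀ q, p.eval (ζ q) = 0) (N : ℕ) :
    ‖(bandMatrix p m N).det‖ * ‖(expMatrix (fun q => topExp m n N (Sum.inr q)) ζ).det‖ =
      ‖p.coeff (m + n)‖ ^ N * ‖(expMatrix (fun q => bandExp m n N (Sum.inr q)) ζ).det‖ := by
  classical
  obtain ⟨E, hE⟩ := exists_equiv_bandExp m n N
  obtain ⟨E', hE'⟩ := exists_equiv_topExp m n N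
  have hinj : Function.Injective (bandExp m n N) := fun a b h =>
    E.injective (Fin.ext (by rw [hE, hE, h]))
  have hinj' : Function.Injective (topExp m n N) := fun a b h =>
    E'.injective (Fin.ext (by rw [hE', hE', h]))
  -- The shifted copies of `p`, completed by the coordinate forms of the lowest exponents.
  set A : Matrix (Fin N ⊕ (Fin m ⊕ Fin n)) (Fin N ⊕ (Fin m ⊕ Fin n)) ℂ := Matrix.of fun k c =>
    Sum.elim (fun i : Fin N => (p * X ^ (i : ℕ)).coeff (bandExp m n N c))
      (fun q => if bandExp m n N c = topExp m n N (Sum.inr q) then 1 else 0) k with hA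
  -- The last columns of `V` are the power vectors of the roots, which the first rows of `A`
  -- annihilate.
  set V : Matrix (Fin N ⊕ (Fin m ⊕ Fin n)) (Fin N ⊕ (Fin m ⊕ Fin n)) ℂ :=
    fromBlocks 1 (expMatrix (fun i => bandExp m n N (Sum.inl i)) ζ) 0
      (expMatrix (fun q => bandExp m n N (Sum.inr q)) ζ) with hV
  have hVr : ∀ c q, V c (Sum.inr q) = ζ q ^ bandExp m n N c := by
    rintro (c | c) q <;> simp [hV, expMatrix]
  have hAV : A * V = fromBlocks (bandMatrix p m N) 0
      ((A * V).toBlocks₂₁) (expMatrix (fun q => topExp m n N (Sum.inr q)) ζ) := by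
    conv_lhs => rw [← fromBlocks_toBlocks (A * V)]
    congr 1
    · ext i j
      simp [toBlocks₁₁, hA, hV, Matrix.mul_apply, Fintype.sum_sum_type, Matrix.one_apply,
        bandMatrix, bandExp]
    · ext i q
      simp only [toBlocks₁₂, Matrix.of_apply, Matrix.mul_apply, hVr, Matrix.zero_apply]
      simp only [hA, Matrix.of_apply, Sum.elim_inl]
      have h1 : ∑ c, (p * X ^ (i : ℕ)).coeff (bandExp m n N c) * ζ q ^ bandExp m n N c =
          ∑ k : Fin (m + n + N), (p * X ^ (i : ℕ)).coeff k * ζ q ^ (k : ℕ) := by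
        rw [← E.sum_comp]
        simp only [hE]
      have h2 := Fin.sum_univ_eq_sum_range
        (fun k => (p * X ^ (i : ℕ)).coeff k * ζ q ^ k) (m + n + N)
      refine h1.trans (h2.trans ?_)
      rw [← eval_eq_sum_range', eval_mul, hζ q, zero_mul]
      have := natDegree_mul_le (p := p) (q := X ^ (i : ℕ))
      rw [natDegree_X_pow] at this
      have := i.2
      omega
    · ext q q'
      simp only [toBlocks₂₂, Matrix.of_apply, Matrix.mul_apply, hVr]
      simp only [hA, Matrix.of_apply, Sum.elim_inr, expMatrix]
      rw [Finset.sum_eq_single (E.symm (E' (Sum.inr q)))]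
      · rw [← hE, Equiv.apply_symm_apply, hE', if_pos rfl, one_mul]
      · intro c _ hc
        rw [if_neg, zero_mul]
        intro h
        apply hc
        rw [Equiv.eq_symm_apply]
        exact Fin.ext (by rw [hE, hE', h])
      · simp
  have hdetV : V.det = (expMatrix (fun q => bandExp m n N (Sum.inr q)) ζ).det := by
    rw [hV, det_fromBlocks_zero₂₁, det_one, one_mul]
  have hdetAV : A.det * V.det = (bandMatrix p m N).det *
      (expMatrix (fun q => topExp m n N (Sum.inr q)) ζ).det := by
    rw [← det_mul, hAV, det_fromBlocks_zero₁₂]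
  -- Reordering the columns by increasing exponent makes `A` triangular.
  set σ : Equiv.Perm (Fin N ⊕ (Fin m ⊕ Fin n)) := E'.trans E.symm with hσ
  have hσe : ∀ c, bandExp m n N (σ c) = topExp m n N c := fun c => by
    rw [← hE, hσ, Equiv.trans_apply, Equiv.apply_symm_apply, hE']
  have hAσ : A.submatrix id σ = fromBlocks
      (Matrix.of fun i j : Fin N => (p * X ^ (i : ℕ)).coeff (m + n + j))
      ((A.submatrix id σ).toBlocks₁₂) 0 1 := by
    conv_lhs => rw [← fromBlocks_toBlocks (A.submatrix id σ)]
    congr 1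
    · ext i j
      simp [toBlocks₁₁, hA, hσe, topExp]
    · ext q j
      simp [toBlocks₂₁, hA, hσe, hinj'.eq_iff]
    · ext q q'
      simp [toBlocks₂₂, hA, hσe, hinj'.eq_iff, Matrix.one_apply, eq_comm]
  have hdetA : ‖A.det‖ = ‖p.coeff (m + n)‖ ^ N := by
    have h1 := det_permute' σ A
    rw [hAσ, det_fromBlocks_zero₂₁, det_one, mul_one, det_of_isLowerTriangular] at h1
    · have h2 := congrArg norm h1
      rw [norm_mul] at h2
      have h3 : ‖((Equiv.Perm.sign σ : ℤ) : ℂ)‖ = 1 := by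
        rcases Int.units_eq_one_or (Equiv.Perm.sign σ) with h | h <;> simp [h]
      rw [h3, one_mul] at h2
      rw [← h2]
      simp [coeff_mul_X_pow]
    · intro i j hij
      have hij' : (i : ℕ) < j := hij
      simp only [Matrix.of_apply]
      refine coeff_eq_zero_of_natDegree_lt ?_
      have := natDegree_mul_le (p := p) (q := X ^ (i : ℕ))
      rw [natDegree_X_pow] at this
      omega
  rw [← norm_mul, ← hdetAV, norm_mul, hdetA, hdetV]

/-- With the exponents `0, …, m + n - 1` the generalized Vandermonde matrix is an ordinary one. -/
lemma det_expMatrix_topExp_ne_zero {m n N : ℕ} {ζ : Fin m ⊕ Fin n → ℂ}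
    (hζ : Function.Injective ζ) :
    (expMatrix (fun q => topExp m n N (Sum.inr q)) ζ).det ≠ 0 := by
  have h : expMatrix (fun q => topExp m n N (Sum.inr q)) ζ =
      (vandermonde (ζ ∘ finSumFinEquiv.symm))ᵀ.submatrix finSumFinEquiv finSumFinEquiv := by
    ext q q'
    rcases q with q | q <;> simp [expMatrix, topExp, vandermonde]
  rw [h, det_submatrix_equiv_self, det_transpose, det_vandermonde_ne_zero_iff]
  exact hζ.comp finSumFinEquiv.symm.injective

/-- The generalized Vandermonde determinant, normalized by the `N`-th powers of the large points
`l`. The scale `ϱ` is divided out of the lower rows and returned in the columns of `l`, so that the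
remaining `N`-th powers are those of ratios of modulus below `1` if `ϱ` separates `s` from `l`. -/
lemma det_expMatrix_bandExp {m n : ℕ} (s : Fin m → ℂ) {l : Fin n → ℂ} (hl : ∀ j, l j ≠ 0)
    {ϱ : ℂ} (hϱ : ϱ ≠ 0) (N : ℕ) :
    (expMatrix (fun q => bandExp m n N (Sum.inr q)) (Sum.elim s l)).det =
      (∏ j, l j) ^ N * (fromBlocks (Matrix.of fun k j => s j ^ (k : ℕ))
        (Matrix.of fun k j => l j ^ (k : ℕ) * (ϱ / l j) ^ N)
        (Matrix.of fun k j => s j ^ (m + k : ℕ) * (s j / ϱ) ^ N)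
        (Matrix.of fun k j => l j ^ (m + k : ℕ)) :
          Matrix (Fin m ⊕ Fin n) (Fin m ⊕ Fin n) ℂ).det := by
  set S : Matrix (Fin m ⊕ Fin n) (Fin m ⊕ Fin n) ℂ :=
    fromBlocks (Matrix.of fun k j => s j ^ (k : ℕ))
        (Matrix.of fun k j => l j ^ (k : ℕ) * (ϱ / l j) ^ N)
        (Matrix.of fun k j => s j ^ (m + k : ℕ) * (s j / ϱ) ^ N)
        (Matrix.of fun k j => l j ^ (m + k : ℕ)) with hS
  have h : expMatrix (fun q => bandExp m n N (Sum.inr q)) (Sum.elim s l) =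
      diagonal (Sum.elim (fun _ => 1) fun _ => ϱ ^ N) * S *
        diagonal (Sum.elim (fun _ => 1) fun j => (l j / ϱ) ^ N) := by
    ext q q'
    rw [mul_diagonal, diagonal_mul]
    rcases q with q | q <;> rcases q' with q' | q' <;>
      simp only [expMatrix, bandExp, hS, Matrix.of_apply, Sum.elim_inl, Sum.elim_inr,
        fromBlocks_apply₁₁, fromBlocks_apply₁₂, fromBlocks_apply₂₁, fromBlocks_apply₂₂, one_mul,
        mul_one]
    · rw [mul_assoc, ← mul_pow, div_mul_div_cancel₀ (hl q'), div_self hϱ, one_pow, mul_one]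
    · rw [mul_left_comm, ← mul_pow, mul_div_cancel₀ _ hϱ]; ring
    · rw [mul_right_comm, ← mul_pow, mul_div_cancel₀ _ hϱ]; ring
  rw [h, det_mul, det_mul, det_diagonal, det_diagonal, Fintype.prod_sum_type,
    Fintype.prod_sum_type]
  simp only [Sum.elim_inl, Sum.elim_inr, Finset.prod_const_one, one_mul]
  rw [mul_right_comm, ← Finset.prod_mul_distrib]
  congr 1
  rw [← Finset.prod_pow]
  refine Finset.prod_congr rfl fun j _ => ?_
  rw [← mul_pow, mul_div_cancel₀ _ hϱ]

/-- Exponential growth rate of banded Toeplitz determinants, for simple roots separated by a circle.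
The normalized generalized Vandermonde determinant tends to a product of two Vandermonde
determinants, which does not vanish. -/
theorem tendsto_log_norm_det_bandMatrix {m n : ℕ} {p : ℂ[X]} (hp : p.natDegree ≤ m + n)
    (hlead : p.coeff (m + n) ≠ 0) {s : Fin m → ℂ} {l : Fin n → ℂ}
    (hs0 : ∀ j, p.eval (s j) = 0) (hl0 : ∀ j, p.eval (l j) = 0)
    (hs : Function.Injective s) (hl : Function.Injective l) {ϱ : ℝ} (hϱ : 0 < ϱ)
    (hsϱ : ∀ j, ‖s j‖ < ϱ) (hlϱ : ∀ j, ϱ < ‖l j‖) :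
    Tendsto (fun N : ℕ => (N : ℝ)⁻¹ * Real.log ‖(bandMatrix p m N).det‖) atTop
      (𝓝 (Real.log ‖p.coeff (m + n)‖ + ∑ j, Real.log ‖l j‖)) ∧
    ∀ᶠ N : ℕ in atTop, (bandMatrix p m N).det ≠ 0 := by
  have hϱ' : (ϱ : ℂ) ≠ 0 := by exact_mod_cast hϱ.ne'
  have hln : ∀ j, 0 < ‖l j‖ := fun j => hϱ.trans (hlϱ j)
  have hlne : ∀ j, l j ≠ 0 := fun j => norm_pos_iff.1 (hln j)
  have hinj : Function.Injective (Sum.elim s l) := hs.sumElim hl fun i j h => by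
    have h1 := hsϱ i
    have h2 := hlϱ j
    rw [h] at h1
    exact lt_asymm h1 h2
  have hroot : ∀ q, p.eval (Sum.elim s l q) = 0 := by rintro (q | q) <;> simp [hs0, hl0]
  set S : ℕ → Matrix (Fin m ⊕ Fin n) (Fin m ⊕ Fin n) ℂ := fun N =>
    fromBlocks (Matrix.of fun k j => s j ^ (k : ℕ))
        (Matrix.of fun k j => l j ^ (k : ℕ) * (ϱ / l j) ^ N)
        (Matrix.of fun k j => s j ^ (m + k : ℕ) * (s j / ϱ) ^ N)
        (Matrix.of fun k j => l j ^ (m + k : ℕ)) with hS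
  set S' : Matrix (Fin m ⊕ Fin n) (Fin m ⊕ Fin n) ℂ :=
    fromBlocks (Matrix.of fun k j => s j ^ (k : ℕ)) 0 0
        (Matrix.of fun k j => l j ^ (m + k : ℕ)) with hS'
  have hSlim : Tendsto S atTop (𝓝 S') := by
    refine tendsto_pi_nhds.2 fun q => tendsto_pi_nhds.2 fun q' => ?_
    rcases q with q | q <;> rcases q' with q' | q' <;>
      simp only [hS, hS', Matrix.of_apply, fromBlocks_apply₁₁, fromBlocks_apply₁₂,
        fromBlocks_apply₂₁, fromBlocks_apply₂₂, Matrix.zero_apply]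
    · exact tendsto_const_nhds
    · have : ‖(ϱ : ℂ) / l q'‖ < 1 := by
        rw [norm_div, div_lt_one (hln q'), Complex.norm_real, Real.norm_of_nonneg hϱ.le]
        exact hlϱ q'
      simpa using (tendsto_pow_atTop_nhds_zero_of_norm_lt_one this).const_mul (l q' ^ (q : ℕ))
    · have : ‖s q' / (ϱ : ℂ)‖ < 1 := by
        rw [norm_div, Complex.norm_real, Real.norm_of_nonneg hϱ.le, div_lt_one hϱ]
        exact hsϱ q'
      simpa using (tendsto_pow_atTop_nhds_zero_of_norm_lt_one this).const_mul (s q' ^ (m + q : ℕ))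
    · exact tendsto_const_nhds
  have hdet : Tendsto (fun N => ‖(S N).det‖) atTop (𝓝 ‖S'.det‖) :=
    ((continuous_id.matrix_det.tendsto S').comp hSlim).norm
  have hS'0 : S'.det ≠ 0 := by
    have h1 : (Matrix.of fun (k : Fin m) j => s j ^ (k : ℕ)) = (vandermonde s)ᵀ := rfl
    have h2 : (Matrix.of fun (k : Fin n) j => l j ^ (m + k : ℕ)) =
        (vandermonde l)ᵀ * diagonal fun j => l j ^ m := by
      ext k j
      rw [mul_diagonal]
      simp [vandermonde, pow_add, mul_comm]
    rw [hS', det_fromBlocks_zero₂₁, h1, h2, det_mul, det_transpose, det_transpose, det_diagonal]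
    exact mul_ne_zero (det_vandermonde_ne_zero_iff.2 hs) (mul_ne_zero
      (det_vandermonde_ne_zero_iff.2 hl)
      (Finset.prod_ne_zero_iff.2 fun j _ => pow_ne_zero _ (hlne j)))
  set C : ℝ := ‖(expMatrix (fun q => topExp m n 0 (Sum.inr q)) (Sum.elim s l)).det‖ with hC
  have hC0 : 0 < C := norm_pos_iff.2 (det_expMatrix_topExp_ne_zero hinj)
  have hform : ∀ N, ‖(bandMatrix p m N).det‖ =
      (‖p.coeff (m + n)‖ * ∏ j, ‖l j‖) ^ N * (‖(S N).det‖ / C) := fun N => by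
    have h := norm_det_bandMatrix_mul hp hroot N
    rw [det_expMatrix_bandExp s hlne hϱ' N, norm_mul, norm_pow, norm_prod] at h
    have hC' : ‖(expMatrix (fun q => topExp m n N (Sum.inr q)) (Sum.elim s l)).det‖ = C := rfl
    rw [hC'] at h
    rw [← mul_div_assoc, eq_div_iff hC0.ne', h, mul_pow, mul_assoc]
  have hb : 0 < ‖p.coeff (m + n)‖ * ∏ j, ‖l j‖ :=
    mul_pos (norm_pos_iff.2 hlead) (Finset.prod_pos fun j _ => hln j)
  have hSpos : ∀ᶠ N in atTop, 0 < ‖(S N).det‖ :=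
    hdet.eventually (lt_mem_nhds (norm_pos_iff.2 hS'0))
  refine ⟨?_, ?_⟩
  · have hlog : Tendsto (fun N : ℕ => (N : ℝ)⁻¹ * Real.log (‖(S N).det‖ / C)) atTop (𝓝 0) := by
      have h1 := (hdet.div_const C).log (div_pos (norm_pos_iff.2 hS'0) hC0).ne'
      simpa using tendsto_inv_atTop_nhds_zero_nat.mul h1
    have htot := hlog.const_add (Real.log ‖p.coeff (m + n)‖ + ∑ j, Real.log ‖l j‖)
    rw [add_zero] at htot
    refine htot.congr' ?_
    filter_upwards [hSpos, eventually_gt_atTop 0] with N hN hN0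
    rw [hform N, Real.log_mul (pow_pos hb N).ne' (div_pos hN hC0).ne', Real.log_pow,
      Real.log_mul (norm_pos_iff.2 hlead).ne' (Finset.prod_pos fun j _ => hln j).ne',
      Real.log_prod fun j _ => (hln j).ne', mul_add, inv_mul_cancel_left₀ (by positivity)]
  · filter_upwards [hSpos] with N hN
    rw [← norm_pos_iff, hform N]
    exact mul_pos (pow_pos hb N) (div_pos hN hC0)

end

/-! ### Perturbation of determinants, and eigenvalues -/

section

open Matrix

/-- Expand the product of the row sums; the terms of the determinant are among the summands. -/
lemma norm_det_le_prod_sum {N : ℕ} (M : Matrix (Fin N) (Fin N) ℂ) :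
    ‖M.det‖ ≤ ∏ i, ∑ j, ‖M i j‖ := by
  rw [← det_transpose, det_apply']
  calc ‖∑ σ : Equiv.Perm (Fin N), ((Equiv.Perm.sign σ : ℤ) : ℂ) * ∏ i, Mᵀ (σ i) i‖
      ≤ ∑ σ : Equiv.Perm (Fin N), ∏ i, ‖M i (σ i)‖ := by
        refine norm_sum_le_of_le _ fun σ _ => ?_
        have h3 : ‖((Equiv.Perm.sign σ : ℤ) : ℂ)‖ = 1 := by
          rcases Int.units_eq_one_or (Equiv.Perm.sign σ) with h | h <;> simp [h]
        rw [norm_mul, h3, one_mul, norm_prod]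
        rfl
    _ ≤ ∑ f : Fin N → Fin N, ∏ i, ‖M i (f i)‖ := by
        rw [← Finset.sum_image (s := (Finset.univ : Finset (Equiv.Perm (Fin N))))
          (g := fun σ => (σ : Fin N → Fin N)) (f := fun f => ∏ i, ‖M i (f i)‖)
          fun σ _ τ _ h => DFunLike.coe_injective h]
        exact Finset.sum_le_sum_of_subset_of_nonneg (Finset.subset_univ _)
          fun _ _ _ => Finset.prod_nonneg fun _ _ => norm_nonneg _
    _ = ∏ i, ∑ j, ‖M i j‖ := by
        rw [Finset.prod_univ_sum]
        simp

lemma norm_det_add_sub_det_le {N : ℕ} (M B : Matrix (Fin N) (Fin N) ℂ) {K β : ℝ} (hK : 0 ≤ K)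
    (hβ0 : 0 ≤ β) (hM : ∀ i, ∑ j, ‖M i j‖ ≤ K) (hMB : ∀ i, ∑ j, ‖(M + B) i j‖ ≤ K)
    (hβ : ∀ i, ∑ j, ‖B i j‖ ≤ β) :
    ‖(M + B).det - M.det‖ ≤ N * K ^ (N - 1) * β := by
  -- The determinant is multilinear in the rows, which carry the `ℓ¹` norm.
  let f : MultilinearMap ℂ (fun _ : Fin N => PiLp 1 (fun _ : Fin N => ℂ)) ℂ :=
    (detRowAlternating (n := Fin N) (R := ℂ)).toMultilinearMap.compLinearMap
      fun _ => (WithLp.linearEquiv 1 ℂ (Fin N → ℂ)).toLinearMap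
  let r : Matrix (Fin N) (Fin N) ℂ → Fin N → PiLp 1 (fun _ : Fin N => ℂ) :=
    fun A i => WithLp.toLp 1 (A i)
  have hf : ∀ A, f (r A) = A.det := fun A => rfl
  have hr : ∀ A i, ‖r A i‖ = ∑ j, ‖A i j‖ := fun A i => PiLp.norm_eq_of_L1 _
  have h := f.norm_image_sub_le_of_bound zero_le_one (fun m => by
    rw [one_mul]
    have := norm_det_le_prod_sum (Matrix.of fun i j => m i j)
    simp only [PiLp.norm_eq_of_L1]
    exact this) (r (M + B)) (r M)
  rw [hf, hf, one_mul, Fintype.card_fin] at h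
  refine h.trans ?_
  have hrn : ∀ A : Matrix (Fin N) (Fin N) ℂ, ∀ c, 0 ≤ c → (∀ i, ∑ j, ‖A i j‖ ≤ c) → ‖r A‖ ≤ c :=
    fun A c hc hA => (pi_norm_le_iff_of_nonneg hc).2 fun i => by rw [hr]; exact hA i
  have hsub : r (M + B) - r M = r B := by
    ext i j; simp [r]
  rw [hsub]
  gcongr
  · exact max_le (hrn _ _ hK hMB) (hrn _ _ hK hM)
  · exact hrn _ _ hβ0 hβ

/-- A super-exponentially small perturbation does not affect the exponential growth rate of the
determinants. -/
theorem tendsto_log_norm_det_add {M B : ∀ N : ℕ, Matrix (Fin N) (Fin N) ℂ} {S ℓ : ℝ} {η : ℕ → ℝ}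
    (hM : ∀ N i, ∑ j, ‖M N i j‖ ≤ S) (hB : ∀ᶠ N in atTop, ∀ i j, ‖B N i j‖ ≤ η N)
    (hη : ∀ c : ℝ, ∀ᶠ N : ℕ in atTop, (N : ℝ) ^ 2 * η N ≤ Real.exp (-(c * N)))
    (hlim : Tendsto (fun N : ℕ => (N : ℝ)⁻¹ * Real.log ‖(M N).det‖) atTop (𝓝 ℓ))
    (hne : ∀ᶠ N in atTop, (M N).det ≠ 0) :
    Tendsto (fun N : ℕ => (N : ℝ)⁻¹ * Real.log ‖(M N + B N).det‖) atTop (𝓝 ℓ) ∧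
    ∀ᶠ N in atTop, (M N + B N).det ≠ 0 := by
  set K : ℝ := |S| + 1 with hK
  have hK1 : 1 ≤ K := by have := abs_nonneg S; linarith
  have hK0 : 0 < K := by linarith
  -- `|det (M + B) - det M| ≤ N² K ^ N η`, while `|det M| ≥ e ^ ((ℓ - 1) N)`.
  have hratio : ∀ᶠ N : ℕ in atTop,
      |‖(M N + B N).det‖ / ‖(M N).det‖ - 1| ≤ Real.exp (-(1 * N)) := by
    filter_upwards [hB, hη (Real.log K - ℓ + 2), hη 0, hne, eventually_gt_atTop 0,
      hlim.eventually (lt_mem_nhds (show ℓ - 1 < ℓ by linarith))] with N h1 h2 h2' h3 h4 h5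
    have hN : (1 : ℝ) ≤ N := by exact_mod_cast h4
    have hη0 : 0 ≤ η N := (norm_nonneg _).trans (h1 ⟨0, h4⟩ ⟨0, h4⟩)
    have hdet0 : 0 < ‖(M N).det‖ := norm_pos_iff.2 h3
    have hBrow : ∀ i, ∑ j, ‖B N i j‖ ≤ N * η N := fun i => by
      calc _ ≤ ∑ _j : Fin N, η N := Finset.sum_le_sum fun j _ => h1 i j
        _ = _ := by simp
    have hNη : N * η N ≤ 1 := by
      simp only [zero_mul, neg_zero, Real.exp_zero] at h2'
      nlinarith [mul_nonneg (by linarith : (0:ℝ) ≤ N) hη0]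
    have hd := norm_det_add_sub_det_le (M N) (B N) hK0.le (by positivity : 0 ≤ N * η N)
      (fun i => (hM N i).trans (by have := le_abs_self S; linarith)) (fun i => by
        calc _ ≤ ∑ j, (‖M N i j‖ + ‖B N i j‖) := Finset.sum_le_sum fun j _ => norm_add_le _ _
          _ = ∑ j, ‖M N i j‖ + ∑ j, ‖B N i j‖ := Finset.sum_add_distrib
          _ ≤ S + 1 := add_le_add (hM N i) ((hBrow i).trans hNη)
          _ ≤ K := by have := le_abs_self S; linarith) hBrow
    have hlow : Real.exp ((ℓ - 1) * N) ≤ ‖(M N).det‖ := by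
      rw [← Real.le_log_iff_exp_le hdet0]
      rw [lt_inv_mul_iff₀ (by linarith)] at h5
      linarith
    have hKN : K ^ (N - 1) ≤ Real.exp (Real.log K * N) := by
      rw [mul_comm, Real.exp_nat_mul, Real.exp_log hK0]
      exact pow_le_pow_right₀ hK1 (Nat.sub_le _ _)
    have : |‖(M N + B N).det‖ / ‖(M N).det‖ - 1| ≤
        ‖(M N + B N).det - (M N).det‖ / ‖(M N).det‖ := by
      rw [le_div_iff₀ hdet0, ← abs_of_pos hdet0, ← abs_mul, sub_mul, one_mul, abs_of_pos hdet0,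
        div_mul_cancel₀ _ hdet0.ne']
      exact abs_norm_sub_norm_le _ _
    refine this.trans ?_
    rw [div_le_iff₀ hdet0]
    calc _ ≤ N * K ^ (N - 1) * (N * η N) := hd
      _ = K ^ (N - 1) * ((N : ℝ) ^ 2 * η N) := by ring
      _ ≤ Real.exp (Real.log K * N) * Real.exp (-((Real.log K - ℓ + 2) * N)) := by
          gcongr
      _ = Real.exp (-(1 * N)) * Real.exp ((ℓ - 1) * N) := by
          rw [← Real.exp_add, ← Real.exp_add]; congr 1; ring
      _ ≤ _ := by gcongr
  have hexp : Tendsto (fun N : ℕ => Real.exp (-(1 * (N : ℝ)))) atTop (𝓝 0) := by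
    simp only [one_mul]
    exact Real.tendsto_exp_neg_atTop_nhds_zero.comp tendsto_natCast_atTop_atTop
  have hq : Tendsto (fun N => ‖(M N + B N).det‖ / ‖(M N).det‖) atTop (𝓝 1) := by
    rw [← tendsto_sub_nhds_zero_iff]
    exact squeeze_zero_norm' hratio hexp
  have hqpos : ∀ᶠ N in atTop, 0 < ‖(M N + B N).det‖ / ‖(M N).det‖ :=
    hq.eventually (lt_mem_nhds one_pos)
  refine ⟨?_, ?_⟩
  · have h1 := tendsto_inv_atTop_nhds_zero_nat (𝕜 := ℝ) |>.mul (hq.log one_ne_zero)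
    have h2 := hlim.add h1
    rw [zero_mul, add_zero] at h2
    refine h2.congr' ?_
    filter_upwards [hqpos, hne] with N h3 h4
    have hdet0 : 0 < ‖(M N).det‖ := norm_pos_iff.2 h4
    rw [← mul_add, ← Real.log_mul hdet0.ne' h3.ne', mul_div_cancel₀ _ hdet0.ne']
  · filter_upwards [hqpos] with N h3 h4
    simp [h4] at h3

/-- Eigenvalues are bounded by the largest `ℓ¹` norm of a row (Gershgorin). -/
lemma norm_le_of_mem_roots_charpoly {N : ℕ} {M : Matrix (Fin N) (Fin N) ℂ} {R : ℝ}
    (hM : ∀ i, ∑ j, ‖M i j‖ ≤ R) {w : ℂ} (hw : w ∈ M.charpoly.roots) : ‖w‖ ≤ R := by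
  by_contra! hR
  have h0 : M.charpoly.eval w = 0 := Polynomial.isRoot_of_mem_roots hw
  rw [eval_charpoly] at h0
  refine det_ne_zero_of_sum_row_lt_diag (fun i => ?_) h0
  have h1 := hM i
  rw [← Finset.add_sum_erase _ _ (Finset.mem_univ i)] at h1
  have h2 : ∑ j ∈ Finset.univ.erase i, ‖(scalar (Fin N) w - M) i j‖ =
      ∑ j ∈ Finset.univ.erase i, ‖M i j‖ := Finset.sum_congr rfl fun j hj => by
    simp [Ne.symm (Finset.ne_of_mem_erase hj)]
  have h3 : ‖w‖ - ‖M i i‖ ≤ ‖(scalar (Fin N) w - M) i i‖ := by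
    simpa using norm_sub_norm_le w (M i i)
  rw [h2]
  linarith

lemma card_roots_charpoly {N : ℕ} (M : Matrix (Fin N) (Fin N) ℂ) :
    M.charpoly.roots.card = N := by
  rw [IsAlgClosed.card_roots_eq_natDegree, charpoly_natDegree_eq_dim, Fintype.card_fin]

lemma logAvg_roots_charpoly {N : ℕ} (M : Matrix (Fin N) (Fin N) ℂ) {z : ℂ}
    (hz : (M - scalar (Fin N) z).det ≠ 0) :
    logAvg N M.charpoly.roots z = (N : ℝ)⁻¹ * Real.log ‖(M - scalar (Fin N) z).det‖ := by
  have h1 : ‖(M - scalar (Fin N) z).det‖ = ‖(M.charpoly.roots.map fun w => z - w).prod‖ := by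
    rw [← (IsAlgClosed.splits M.charpoly).eval_eq_prod_roots_of_monic M.charpoly_monic,
      eval_charpoly, ← neg_sub, det_neg, norm_mul, norm_pow, norm_neg, norm_one, one_pow, one_mul]
  have key : ∀ s : Multiset ℂ, (s.map fun w => z - w).prod ≠ 0 →
      Real.log ‖(s.map fun w => z - w).prod‖ = (s.map fun w => Real.log ‖z - w‖).sum := by
    intro s
    induction s using Multiset.induction_on with
    | empty => simp
    | cons a s ih =>
      intro h
      simp only [Multiset.map_cons, Multiset.prod_cons, Multiset.sum_cons] at h ⊢
      rw [norm_mul, Real.log_mul (norm_ne_zero_iff.2 (left_ne_zero_of_mul h))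
        (norm_ne_zero_iff.2 (right_ne_zero_of_mul h)), ih (right_ne_zero_of_mul h)]
  rw [logAvg, h1, key]
  rw [← norm_ne_zero_iff, ← h1]
  exact norm_ne_zero_iff.2 hz

end

/-! ### Values of the symbol attained at points of equal modulus -/

/-- The analytic inverse function theorem, with both inverse identities. -/
lemma exists_analyticAt_localInverse {f : ℂ → ℂ} {x : ℂ} (hf : AnalyticAt ℂ f x)
    (hf' : deriv f x ≠ 0) :
    ∃ g : ℂ → ℂ, AnalyticAt ℂ g (f x) ∧ (∀ᶠ y in 𝓝 x, g (f y) = y) ∧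
      ∀ᶠ y in 𝓝 (f x), f (g y) = y :=
  ⟨_, hf.analyticAt_localInverse hf', HasStrictDerivAt.eventually_left_inverse ..,
    HasStrictDerivAt.eventually_right_inverse ..⟩

/-- An analytic function that is not constant near a point is unimodular, near that point, only on a
null set. -/
lemma exists_nhds_volume_norm_eq_one {k : ℂ → ℂ} {x : ℂ} (hk : AnalyticAt ℂ k x)
    (hne : ¬ ∀ᶠ y in 𝓝 x, k y = k x) :
    ∃ U ∈ 𝓝 x, volume {y ∈ U | ‖k y‖ = 1} = 0 := by
  obtain ⟨r, hr, hball⟩ := Metric.eventually_nhds_iff_ball.1 hk.eventually_analyticAt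
  -- Zeros of the derivative are isolated, as otherwise `k` would be constant near `x`.
  have hd : ∀ᶠ y in 𝓝[≠] x, deriv k y ≠ 0 := by
    refine hk.deriv.eventually_eq_zero_or_eventually_ne_zero.resolve_left fun h => hne ?_
    obtain ⟨r', hr', hball'⟩ := Metric.eventually_nhds_iff_ball.1 h
    filter_upwards [Metric.ball_mem_nhds x (lt_min hr hr')] with y hy
    refine (convex_ball x (min r r')).is_const_of_fderivWithin_eq_zero (𝕜 := ℂ) (f := k)
      (fun z hz => ((hball z (Metric.ball_subset_ball (min_le_left _ _)
        hz)).differentiableAt).differentiableWithinAt) (fun z hz => ?_) hy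
      (Metric.mem_ball_self (lt_min hr hr'))
    rw [fderivWithin_of_isOpen Metric.isOpen_ball hz]
    ext
    simpa using hball' z (Metric.ball_subset_ball (min_le_right _ _) hz)
  rw [eventually_nhdsWithin_iff] at hd
  obtain ⟨r', hr', hball'⟩ := Metric.eventually_nhds_iff_ball.1 hd
  refine ⟨Metric.ball x (min r r'), Metric.ball_mem_nhds x (lt_min hr hr'), ?_⟩
  set A : Set ℂ := {y ∈ Metric.ball x (min r r') | ‖k y‖ = 1} \ {x} with hA
  suffices hA0 : volume A = 0 by
    refine measure_mono_null (t := A ∪ {x}) (fun y hy => ?_) (measure_union_null hA0 (by simp))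
    by_cases hyx : y = x
    · exact Or.inr hyx
    · exact Or.inl ⟨hy, hyx⟩
  refine measure_null_of_locally_null A fun y hy => ?_
  have hyr := Metric.ball_subset_ball (min_le_left r r') hy.1.1
  have hyd := hball' y (Metric.ball_subset_ball (min_le_right r r') hy.1.1) hy.2
  obtain ⟨g, hg, hgl, -⟩ := exists_analyticAt_localInverse (hball y hyr) hyd
  have hW : {w | AnalyticAt ℂ g w} ∈ 𝓝 (k y) := hg.eventually_analyticAt
  refine ⟨A ∩ ({w | g (k w) = w} ∩ k ⁻¹' {w | AnalyticAt ℂ g w}),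
    inter_mem self_mem_nhdsWithin (mem_nhdsWithin_of_mem_nhds
      (inter_mem hgl ((hball y hyr).continuousAt hW))), ?_⟩
  -- Locally the set is the image of a piece of the unit circle under the smooth map `g`.
  have himg : volume (g '' (Metric.sphere 0 1 ∩ {w | AnalyticAt ℂ g w})) = 0 := by
    refine addHaar_image_eq_zero_of_differentiableOn_of_addHaar_eq_zero volume
      (fun w hw => ?_) (measure_mono_null Set.inter_subset_left
        (Measure.addHaar_sphere volume (0 : ℂ) 1))
    exact (hw.2.differentiableAt.restrictScalars ℝ).differentiableWithinAt
  refine measure_mono_null (fun w hw => ?_) himg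
  exact ⟨k w, ⟨by simpa using hw.1.1.2, hw.2.2⟩, hw.2.1⟩

lemma degree_bounds_of_mem_support {a : ℂ[T;T⁻¹]} {k : ℤ} (hk : k ∈ a.coeff.support) :
    k ≤ degPlus a ∧ -(degMinus a : ℤ) ≤ k := by
  have h1 : k.toNat ≤ degPlus a := Finset.le_sup (f := fun n : ℤ => n.toNat) hk
  have h2 : (-k).toNat ≤ degMinus a := Finset.le_sup (f := fun n : ℤ => (-n).toNat) hk
  omega

lemma analyticAt_symbol (a : ℂ[T;T⁻¹]) {w : ℂ} (hw : w ≠ 0) : AnalyticAt ℂ (symbol a) w := by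
  have : symbol a = fun w => ∑ n ∈ a.coeff.support, a.coeff n * w ^ n := rfl
  rw [this]
  exact Finset.analyticAt_fun_sum _ fun n _ => analyticAt_const.mul (analyticAt_id.zpow hw)

/-- A rotation (or dilation) that leaves the symbol invariant near some point fixes every monomial
occurring in it. -/
lemma zpow_eq_one_of_symbol_mul_eq {a : ℂ[T;T⁻¹]} {x c : ℂ} (hx : x ≠ 0)
    (h : ∀ᶠ y in 𝓝 x, symbol a (c * y) = symbol a y) {k : ℤ} (hk : k ∈ a.coeff.support) :
    c ^ k = 1 := by
  set m : ℤ := (degMinus a : ℤ) with hm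
  -- `Q(y) = y ^ m (a(c y) - a(y))` has a neighbourhood of `x` among its roots.
  set Q : Polynomial ℂ := ∑ n ∈ a.coeff.support,
    Polynomial.C (a.coeff n * (c ^ n - 1)) * Polynomial.X ^ (n + m).toNat with hQ
  have hnm : ∀ n ∈ a.coeff.support, 0 ≤ n + m := fun n hn => by
    have := (degree_bounds_of_mem_support hn).2
    omega
  have heval : ∀ y : ℂ, y ≠ 0 → Q.eval y = y ^ m * (symbol a (c * y) - symbol a y) := by
    intro y hy
    rw [hQ, Polynomial.eval_finsetSum, symbol, symbol, ← Finset.sum_sub_distrib, Finset.mul_sum]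
    refine Finset.sum_congr rfl fun n hn => ?_
    have : y ^ (n + m).toNat = y ^ n * y ^ m := by
      rw [← zpow_natCast, Int.toNat_of_nonneg (hnm n hn), zpow_add₀ hy]
    simp only [Polynomial.eval_mul, Polynomial.eval_C, Polynomial.eval_pow, Polynomial.eval_X,
      this, mul_zpow]
    ring
  have hQ0 : Q = 0 := by
    refine Polynomial.eq_zero_of_infinite_isRoot Q ?_
    have hev : ∀ᶠ y in 𝓝 x, Q.IsRoot y := by
      filter_upwards [h, eventually_ne_nhds hx] with y hy hy0
      rw [Polynomial.IsRoot, heval y hy0, hy, sub_self, mul_zero]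
    exact infinite_of_mem_nhds x hev
  have hcoeff : Q.coeff (k + m).toNat = a.coeff k * (c ^ k - 1) := by
    rw [hQ, Polynomial.finsetSum_coeff, Finset.sum_eq_single k]
    · rw [Polynomial.coeff_C_mul, Polynomial.coeff_X_pow_self, mul_one]
    · intro n hn hnk
      rw [Polynomial.coeff_C_mul, Polynomial.coeff_X_pow, if_neg, mul_zero]
      have := hnm n hn
      have := hnm k hk
      omega
    · exact fun h => absurd hk h
  rw [hQ0, Polynomial.coeff_zero] at hcoeff
  have := (mul_eq_zero.1 hcoeff.symm).resolve_left (Finsupp.mem_support_iff.1 hk)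
  exact sub_eq_zero.1 this

/-- The pairs of nonzero points of equal modulus, the second one noncritical, at which the symbol
takes the same value and which do not differ by a rotation that leaves the symbol invariant. -/
def badPairs (a : ℂ[T;T⁻¹]) : Set (ℂ × ℂ) :=
  {q | q.1 ≠ 0 ∧ ‖q.1‖ = ‖q.2‖ ∧ symbol a q.1 = symbol a q.2 ∧ deriv (symbol a) q.2 ≠ 0 ∧
    ∃ k ∈ a.coeff.support, (q.2 / q.1) ^ k ≠ 1}

/-- Near a bad pair, the second point is an analytic function of the first, and the quotient of the
two is not constant; hence it is unimodular only on a null set. -/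
lemma volume_fst_badPairs (a : ℂ[T;T⁻¹]) : volume (Prod.fst '' badPairs a) = 0 := by
  -- The Lindelöf property is used in `ℂ × ℂ`, for the outer measure `S ↦ volume (Prod.fst '' S)`.
  have h := measure_null_of_locally_null
    (μ := OuterMeasure.comap Prod.fst (volume : Measure ℂ).toOuterMeasure) (badPairs a)
  refine h fun q hq => ?_
  obtain ⟨x, y⟩ := q
  obtain ⟨hx, hxy, hval, hdy, k, hk, hk1⟩ := hq
  simp only at hx hxy hval hdy hk1
  have hy : y ≠ 0 := by
    rw [← norm_pos_iff, ← hxy]; exact norm_pos_iff.2 hx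
  obtain ⟨g, hg, hgl, hgr⟩ := exists_analyticAt_localInverse (analyticAt_symbol a hy) hdy
  have hgy : g (symbol a y) = y := hgl.self_of_nhds
  have hkan : AnalyticAt ℂ (fun w => g (symbol a w) / w) x := by
    refine AnalyticAt.div (AnalyticAt.fun_comp ?_ (analyticAt_symbol a hx)) analyticAt_id hx
    rwa [hval]
  obtain ⟨U, hU, hU0⟩ := exists_nhds_volume_norm_eq_one hkan fun hconst => hk1 (by
    refine zpow_eq_one_of_symbol_mul_eq hx ?_ hk
    have hcont := (analyticAt_symbol a hx).continuousAt
    rw [← hval] at hgr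
    filter_upwards [hconst, hcont hgr, eventually_ne_nhds hx] with w hw hw2 hw0
    have hw3 : symbol a (g (symbol a w)) = symbol a w := hw2
    rw [hval, hgy] at hw
    rw [← (div_eq_iff hw0).1 hw, hw3])
  refine ⟨badPairs a ∩ (U ×ˢ {w | g (symbol a w) = w}), inter_mem self_mem_nhdsWithin
    (mem_nhdsWithin_of_mem_nhds (prod_mem_nhds hU hgl)), ?_⟩
  rw [OuterMeasure.comap_apply]
  refine measure_mono_null ?_ hU0
  rintro _ ⟨⟨w, v⟩, ⟨⟨hw0, hwv, hval', -⟩, hwU, hv⟩, rfl⟩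
  simp only [Set.mem_ofPred_eq] at hw0 hwv hval' hv ⊢
  refine ⟨hwU, ?_⟩
  rw [hval', hv, norm_div, ← hwv, div_self (norm_ne_zero_iff.2 hw0)]

lemma volume_symbol_badPairs (a : ℂ[T;T⁻¹]) :
    volume (symbol a '' (Prod.fst '' badPairs a)) = 0 := by
  refine addHaar_image_eq_zero_of_differentiableOn_of_addHaar_eq_zero volume ?_
    (volume_fst_badPairs a)
  rintro _ ⟨q, hq, rfl⟩
  exact ((analyticAt_symbol a hq.1).differentiableAt.restrictScalars ℝ).differentiableWithinAt

/-- Sard's theorem for the symbol. -/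
lemma volume_symbol_critical (a : ℂ[T;T⁻¹]) :
    volume (symbol a '' {w | w ≠ 0 ∧ deriv (symbol a) w = 0}) = 0 := by
  refine addHaar_image_eq_zero_of_det_fderivWithin_eq_zero volume (f' := fun _ => 0)
    (fun w hw => ?_) fun w _ => ?_
  · have h := (analyticAt_symbol a hw.1).differentiableAt.hasDerivAt
    rw [hw.2] at h
    have h2 := (h.hasFDerivAt.restrictScalars ℝ).hasFDerivWithinAt
      (s := {w | w ≠ 0 ∧ deriv (symbol a) w = 0})
    refine h2.congr_fderiv ?_
    ext v
    simp
  · rw [ContinuousLinearMap.det, ContinuousLinearMap.toLinearMap_zero, LinearMap.det_zero]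
    simp

/-- A value is generic if it is no critical value of the symbol, is not taken at a bad pair, and
differs from the constant coefficient. The last condition ensures that `shiftedPoly a z` has full
degree and a nonzero constant coefficient. -/
def IsGeneric (a : ℂ[T;T⁻¹]) (z : ℂ) : Prop :=
  z ∉ symbol a '' {w | w ≠ 0 ∧ deriv (symbol a) w = 0} ∧
  z ∉ symbol a '' (Prod.fst '' badPairs a) ∧ z ≠ a.coeff 0

lemma ae_isGeneric (a : ℂ[T;T⁻¹]) : ∀ᵐ z, IsGeneric a z := by
  have h1 := measure_eq_zero_iff_ae_notMem.1 (volume_symbol_critical a)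
  have h2 := measure_eq_zero_iff_ae_notMem.1 (volume_symbol_badPairs a)
  have h3 : ∀ᵐ z : ℂ, z ≠ a.coeff 0 := by simp [ae_iff]
  filter_upwards [h1, h2, h3] with z hz1 hz2 hz3
  exact ⟨hz1, hz2, hz3⟩

/-! ### Roots of the shifted symbol at generic values -/

section

open Polynomial

lemma coeff_eq_zero_of_degPlus_lt {a : ℂ[T;T⁻¹]} {k : ℤ} (hk : (degPlus a : ℤ) < k) :
    a.coeff k = 0 := by
  by_contra h
  have := (degree_bounds_of_mem_support (Finsupp.mem_support_iff.2 h)).1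
  omega

lemma coeff_eq_zero_of_lt_degMinus {a : ℂ[T;T⁻¹]} {k : ℤ} (hk : k < -(degMinus a : ℤ)) :
    a.coeff k = 0 := by
  by_contra h
  have := (degree_bounds_of_mem_support (Finsupp.mem_support_iff.2 h)).2
  omega

lemma coeff_degPlus_ne_zero {a : ℂ[T;T⁻¹]} (h : 0 < degPlus a) : a.coeff (degPlus a : ℤ) ≠ 0 := by
  have hne : a.coeff.support.Nonempty := by
    by_contra hne
    rw [Finset.not_nonempty_iff_eq_empty] at hne
    simp [degPlus, hne] at h
  obtain ⟨k, hk, hk'⟩ := Finset.exists_mem_eq_sup a.coeff.support hne fun n : ℤ => n.toNat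
  have : (degPlus a : ℤ) = k := by
    have : degPlus a = k.toNat := hk'
    omega
  rw [this]
  exact Finsupp.mem_support_iff.1 hk

lemma coeff_neg_degMinus_ne_zero {a : ℂ[T;T⁻¹]} (h : 0 < degMinus a) :
    a.coeff (-(degMinus a : ℤ)) ≠ 0 := by
  have hne : a.coeff.support.Nonempty := by
    by_contra hne
    rw [Finset.not_nonempty_iff_eq_empty] at hne
    simp [degMinus, hne] at h
  obtain ⟨k, hk, hk'⟩ := Finset.exists_mem_eq_sup a.coeff.support hne fun n : ℤ => (-n).toNat
  have : -(degMinus a : ℤ) = k := by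
    have : degMinus a = (-k).toNat := hk'
    omega
  rw [this]
  exact Finsupp.mem_support_iff.1 hk

lemma coeff_shiftedPoly (a : ℂ[T;T⁻¹]) (z : ℂ) (k : ℕ) :
    (shiftedPoly a z).coeff k =
      a.coeff ((k : ℤ) - degMinus a) - if k = degMinus a then z else 0 := by
  rw [shiftedPoly, coeff_sub, finsetSum_coeff, coeff_C_mul, coeff_X_pow]
  congr 1
  · simp only [coeff_C_mul, coeff_X_pow, mul_ite, mul_one, mul_zero]
    rw [Finset.sum_ite_eq (Finset.range (degPlus a + degMinus a + 1)) k]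
    split_ifs with h
    · rfl
    · rw [coeff_eq_zero_of_degPlus_lt]
      simp at h
      omega
  · simp

lemma natDegree_shiftedPoly_le (a : ℂ[T;T⁻¹]) (z : ℂ) :
    (shiftedPoly a z).natDegree ≤ degMinus a + degPlus a := by
  rw [natDegree_le_iff_coeff_eq_zero]
  intro k hk
  rw [coeff_shiftedPoly, if_neg (by omega), coeff_eq_zero_of_degPlus_lt (by omega), sub_zero]

lemma eval_shiftedPoly (a : ℂ[T;T⁻¹]) (z : ℂ) {w : ℂ} (hw : w ≠ 0) :
    (shiftedPoly a z).eval w = w ^ degMinus a * (symbol a w - z) := by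
  rw [shiftedPoly, eval_sub, eval_finsetSum, mul_sub]
  congr 1
  · rw [symbol, Finset.mul_sum]
    symm
    refine Finset.sum_bij_ne_zero (fun n _ _ => (n + degMinus a).toNat) ?_ ?_ ?_ ?_
    · intro n hn _
      have := degree_bounds_of_mem_support hn
      rw [Finset.mem_range]; omega
    · intro n hn _ n' hn' _ h
      have := degree_bounds_of_mem_support hn
      have := degree_bounds_of_mem_support hn'
      omega
    · intro k hk hne
      have hne' : a.coeff ((k : ℤ) - degMinus a) ≠ 0 := fun h0 => hne (by simp [h0])
      refine ⟨(k : ℤ) - degMinus a, Finsupp.mem_support_iff.2 hne', ?_, ?_⟩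
      · exact mul_ne_zero (pow_ne_zero _ hw) (mul_ne_zero hne' (zpow_ne_zero _ hw))
      · omega
    · intro n hn _
      have := degree_bounds_of_mem_support hn
      have h1 : ((n + degMinus a).toNat : ℤ) = n + degMinus a := Int.toNat_of_nonneg (by omega)
      simp only [eval_mul, eval_C, eval_pow, eval_X]
      rw [h1, add_sub_cancel_right, ← zpow_natCast w (n + degMinus a).toNat, h1, zpow_add₀ hw,
        zpow_natCast]
      ring
  · rw [eval_mul, eval_C, eval_pow, eval_X, mul_comm]

section Generic

variable {a : ℂ[T;T⁻¹]} {z : ℂ}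

lemma IsGeneric.coeff_top_ne_zero (hz : IsGeneric a z) :
    (shiftedPoly a z).coeff (degMinus a + degPlus a) ≠ 0 := by
  rw [coeff_shiftedPoly]
  rcases Nat.eq_zero_or_pos (degPlus a) with h | h
  · simp [h, sub_eq_zero, hz.2.2.symm]
  · rw [if_neg (by omega), sub_zero]
    push_cast
    rw [add_sub_cancel_left]
    exact coeff_degPlus_ne_zero h

lemma IsGeneric.natDegree_eq (hz : IsGeneric a z) :
    (shiftedPoly a z).natDegree = degMinus a + degPlus a :=
  le_antisymm (natDegree_shiftedPoly_le a z) (le_natDegree_of_ne_zero hz.coeff_top_ne_zero)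

lemma IsGeneric.ne_zero (hz : IsGeneric a z) : shiftedPoly a z ≠ 0 := fun h =>
  hz.coeff_top_ne_zero (by rw [h, coeff_zero])

lemma IsGeneric.root_ne_zero (hz : IsGeneric a z) {w : ℂ} (hw : (shiftedPoly a z).eval w = 0) :
    w ≠ 0 := by
  rintro rfl
  rw [← coeff_zero_eq_eval_zero, coeff_shiftedPoly] at hw
  rcases Nat.eq_zero_or_pos (degMinus a) with h | h
  · simp [h, sub_eq_zero, hz.2.2.symm] at hw
  · rw [if_neg (by omega), sub_zero, Nat.cast_zero, zero_sub] at hw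
    exact coeff_neg_degMinus_ne_zero h hw

lemma IsGeneric.symbol_eq (hz : IsGeneric a z) {w : ℂ} (hw : (shiftedPoly a z).eval w = 0) :
    symbol a w = z := by
  have h0 := hz.root_ne_zero hw
  rw [eval_shiftedPoly a z h0] at hw
  exact sub_eq_zero.1 ((mul_eq_zero.1 hw).resolve_left (pow_ne_zero _ h0))

/-- A multiple root would be a critical point of the symbol. -/
lemma IsGeneric.nodup_roots (hz : IsGeneric a z) : (shiftedPoly a z).roots.Nodup := by
  classical
  rw [Multiset.nodup_iff_count_le_one]
  intro w
  rw [count_roots]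
  by_contra! h
  obtain ⟨h2, h1⟩ := (one_lt_rootMultiplicity_iff_isRoot hz.ne_zero).1 h
  have hw0 := hz.root_ne_zero h2
  have hsym := hz.symbol_eq h2
  have hd := (analyticAt_symbol a hw0).differentiableAt.hasDerivAt
  have hd2 : HasDerivAt (fun y => y ^ degMinus a * (symbol a y - z))
      ((derivative (shiftedPoly a z)).eval w) w := by
    refine ((shiftedPoly a z).hasDerivAt w).congr_of_eventuallyEq ?_
    filter_upwards [eventually_ne_nhds hw0] with y hy
    rw [eval_shiftedPoly a z hy]
  have hd3 := (hasDerivAt_pow (degMinus a) w).mul (hd.sub_const z)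
  have := hd2.unique hd3
  rw [show (derivative (shiftedPoly a z)).eval w = 0 from h1, hsym, sub_self, mul_zero, zero_add]
    at this
  have hne : deriv (symbol a) w ≠ 0 := fun h0 => hz.1 ⟨w, ⟨hw0, h0⟩, hsym⟩
  exact mul_ne_zero (pow_ne_zero _ hw0) hne this.symm

lemma IsGeneric.card_roots (hz : IsGeneric a z) :
    (shiftedPoly a z).roots.card = degMinus a + degPlus a := by
  rw [IsAlgClosed.card_roots_eq_natDegree, hz.natDegree_eq]

/-- Two roots of equal modulus differ by a rotation that leaves the symbol invariant. -/
lemma IsGeneric.div_zpow_eq_one (hz : IsGeneric a z) {w v : ℂ}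
    (hw : (shiftedPoly a z).eval w = 0) (hv : (shiftedPoly a z).eval v = 0) (h : ‖w‖ = ‖v‖)
    {k : ℤ} (hk : k ∈ a.coeff.support) : (v / w) ^ k = 1 := by
  by_contra hne
  refine hz.2.1 ⟨w, ⟨(w, v), ⟨hz.root_ne_zero hw, h, ?_, fun h0 => ?_, k, hk, hne⟩, rfl⟩,
    hz.symbol_eq hw⟩
  · simp only [hz.symbol_eq hw, hz.symbol_eq hv]
  · exact hz.1 ⟨v, ⟨hz.root_ne_zero hv, h0⟩, hz.symbol_eq hv⟩

/-- The greatest common divisor of the exponents occurring in a Laurent polynomial; the symbol is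
invariant exactly under the rotations whose order divides it. -/
def symmOrder (a : ℂ[T;T⁻¹]) : ℕ := a.coeff.support.gcd Int.natAbs

lemma pow_symmOrder_eq_one_iff (a : ℂ[T;T⁻¹]) (c : ℂ) :
    c ^ symmOrder a = 1 ↔ ∀ k ∈ a.coeff.support, c ^ k = 1 := by
  rw [← orderOf_dvd_iff_pow_eq_one, symmOrder, Finset.dvd_gcd_iff]
  refine forall₂_congr fun k _ => ?_
  rw [orderOf_dvd_iff_pow_eq_one]
  rcases Int.natAbs_eq k with h | h
  · conv_rhs => rw [h, zpow_natCast]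
  · conv_rhs => rw [h, zpow_neg, zpow_natCast, inv_eq_one]

lemma symmOrder_dvd_degPlus (a : ℂ[T;T⁻¹]) : symmOrder a ∣ degPlus a := by
  rcases Nat.eq_zero_or_pos (degPlus a) with h | h
  · simp [h]
  · have := Finset.gcd_dvd (f := Int.natAbs) (Finsupp.mem_support_iff.2 (coeff_degPlus_ne_zero h))
    simpa [symmOrder] using this

lemma symmOrder_pos (h : 0 < degPlus a) : 0 < symmOrder a :=
  Nat.pos_of_dvd_of_pos (symmOrder_dvd_degPlus a) h

lemma symbol_mul_of_pow_symmOrder {c : ℂ} (hc : c ^ symmOrder a = 1) (w : ℂ) :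
    symbol a (c * w) = symbol a w := by
  rw [pow_symmOrder_eq_one_iff] at hc
  refine Finset.sum_congr rfl fun k hk => ?_
  rw [mul_zpow, hc k hk, one_mul]

/-- In a finite set of nonzero points stable under rotation by `g`-th roots of unity, every orbit,
that is every nonempty fibre of `w ↦ w ^ g`, has `g` elements. -/
lemma card_fiber_pow {g : ℕ} (hg : 0 < g) {F : Finset ℂ} (hF0 : ∀ w ∈ F, w ≠ 0)
    (hF : ∀ c : ℂ, c ^ g = 1 → ∀ w ∈ F, c * w ∈ F) {v : ℂ} (hv : v ∈ F) :
    (F.filter fun w => w ^ g = v ^ g).card = g := by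
  have hv0 := hF0 v hv
  have himg : F.filter (fun w => w ^ g = v ^ g) =
      (nthRootsFinset g (1 : ℂ)).image fun c => c * v := by
    ext w
    simp only [Finset.mem_filter, Finset.mem_image, mem_nthRootsFinset hg]
    constructor
    · rintro ⟨-, hw⟩
      refine ⟨w / v, ?_, div_mul_cancel₀ _ hv0⟩
      rw [div_pow, hw, div_self (pow_ne_zero _ hv0)]
    · rintro ⟨c, hc, rfl⟩
      exact ⟨hF c hc v hv, by rw [mul_pow, hc, one_mul]⟩
  rw [himg, Finset.card_image_of_injective _ (mul_left_injective₀ hv0),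
    (Complex.isPrimitiveRoot_exp g hg.ne').card_nthRootsFinset]

lemma dvd_card_of_mul_mem {g : ℕ} (hg : 0 < g) {F : Finset ℂ} (hF0 : ∀ w ∈ F, w ≠ 0)
    (hF : ∀ c : ℂ, c ^ g = 1 → ∀ w ∈ F, c * w ∈ F) : g ∣ F.card := by
  rw [Finset.card_eq_sum_card_image fun w => w ^ g]
  refine Finset.dvd_sum fun y hy => ?_
  obtain ⟨v, hv, rfl⟩ := Finset.mem_image.1 hy
  rw [card_fiber_pow hg hF0 hF hv]

/-- No modulus of roots of `shiftedPoly a z` is attained both among the `degPlus a` largest and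
among the others: roots of equal modulus form a single orbit of the rotations that leave the symbol
invariant, whose order divides `degPlus a`. -/
lemma IsGeneric.not_countP_straddle (hz : IsGeneric a z) (v : ℝ)
    (h1 : (shiftedPoly a z).roots.countP (fun w => v < ‖w‖) < degPlus a)
    (h2 : degPlus a < (shiftedPoly a z).roots.countP (fun w => v ≤ ‖w‖)) : False := by
  classical
  set F := (shiftedPoly a z).roots.toFinset with hF
  set g := symmOrder a with hg
  have hg0 : 0 < g := symmOrder_pos (by omega)
  have hmem : ∀ w, w ∈ F ↔ (shiftedPoly a z).eval w = 0 := fun w => by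
    rw [hF, Multiset.mem_toFinset, mem_roots hz.ne_zero, IsRoot.def]
  -- The roots are simple, so that counting with multiplicity is counting.
  have hcount : ∀ (p : ℂ → Prop) [DecidablePred p],
      (shiftedPoly a z).roots.countP p = (F.filter p).card := fun p _ => by
    rw [Multiset.countP_eq_card_filter, Finset.card_def, Finset.filter_val, hF,
      Multiset.toFinset_val, hz.nodup_roots.dedup]
  have hrot : ∀ c : ℂ, c ^ g = 1 → ∀ w ∈ F, c * w ∈ F := fun c hc w hw => by
    rw [hmem] at hw ⊢
    have hw0 := hz.root_ne_zero hw
    have hc0 : c ≠ 0 := by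
      rintro rfl
      simp [hg0.ne'] at hc
    rw [eval_shiftedPoly a z (mul_ne_zero hc0 hw0), symbol_mul_of_pow_symmOrder hc,
      hz.symbol_eq hw, sub_self, mul_zero]
  have hnorm : ∀ c : ℂ, c ^ g = 1 → ‖c‖ = 1 := fun c hc =>
    Complex.norm_eq_one_of_pow_eq_one hc hg0.ne'
  rw [hcount] at h1 h2
  -- The roots of modulus above `v` are a union of orbits, and those of modulus `v` at most one
  -- orbit.
  have hdvd : g ∣ (F.filter fun w => v < ‖w‖).card := by
    refine dvd_card_of_mul_mem hg0 (fun w hw => ?_) fun c hc w hw => ?_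
    · exact hz.root_ne_zero ((hmem w).1 (Finset.mem_filter.1 hw).1)
    · rw [Finset.mem_filter] at hw ⊢
      exact ⟨hrot c hc w hw.1, by rw [norm_mul, hnorm c hc, one_mul]; exact hw.2⟩
  have hle : (F.filter fun w => v ≤ ‖w‖).card ≤ (F.filter fun w => v < ‖w‖).card + g := by
    have hsplit : F.filter (fun w => v ≤ ‖w‖) =
        F.filter (fun w => v < ‖w‖) ∪ F.filter (fun w => v = ‖w‖) := by
      rw [← Finset.filter_or]
      exact Finset.filter_congr fun w _ => le_iff_lt_or_eq
    rw [hsplit]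
    refine (Finset.card_union_le _ _).trans (Nat.add_le_add_left ?_ _)
    rcases (F.filter fun w => v = ‖w‖).eq_empty_or_nonempty with h | ⟨u, hu⟩
    · simp [h]
    · rw [Finset.mem_filter] at hu
      rw [← card_fiber_pow hg0 (fun w hw => hz.root_ne_zero ((hmem w).1 hw)) hrot hu.1]
      refine Finset.card_le_card fun w hw => ?_
      rw [Finset.mem_filter] at hw ⊢
      refine ⟨hw.1, ?_⟩
      have hu0 := hz.root_ne_zero ((hmem u).1 hu.1)
      have := (pow_symmOrder_eq_one_iff a (w / u)).2 fun k hk =>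
        hz.div_zpow_eq_one ((hmem u).1 hu.1) ((hmem w).1 hw.1) (by rw [← hu.2, ← hw.2]) hk
      rwa [div_pow, div_eq_one_iff_eq (pow_ne_zero _ hu0)] at this
  obtain ⟨q, hq⟩ := hdvd
  obtain ⟨q', hq'⟩ := symmOrder_dvd_degPlus a
  rw [← hg] at hq'
  -- In units of `g`, the number `degPlus a` would lie strictly between consecutive integers.
  rw [hq] at h1 hle
  rw [hq'] at h1 h2
  have e1 : q < q' := lt_of_mul_lt_mul_left h1 (Nat.zero_le g)
  have e2 : g * q' < g * (q + 1) := by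
    rw [mul_add, mul_one]; omega
  have e3 : q' < q + 1 := lt_of_mul_lt_mul_left e2 (Nat.zero_le g)
  omega

end Generic

end

/-! ### The separation of the roots and the limit potential -/

section

open Polynomial

lemma countP_le_of_forall_ge {α : Type*} {p : α → Bool} {L : List α} {n : ℕ}
    (h : ∀ (i : ℕ) (hi : i < L.length), n ≤ i → ¬ p L[i]) : L.countP p ≤ n := by
  rw [← List.take_append_drop n L, List.countP_append]
  have h1 : (L.drop n).countP p = 0 := by
    rw [List.countP_eq_zero]
    intro x hx
    obtain ⟨i, hi, rfl⟩ := List.mem_drop_iff_getElem.1 hx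
    exact h _ _ (by omega)
  rw [h1, add_zero]
  exact List.countP_le_length.trans (List.length_take_le _ _)

lemma le_countP_of_forall_lt {α : Type*} {p : α → Bool} {L : List α} {n : ℕ} (hn : n ≤ L.length)
    (h : ∀ (i : ℕ) (hi : i < L.length), i < n → p L[i]) : n ≤ L.countP p := by
  rw [← List.take_append_drop n L, List.countP_append]
  have h1 : (L.take n).countP p = (L.take n).length := by
    rw [List.countP_eq_length]
    intro x hx
    obtain ⟨i, hi, rfl⟩ := List.mem_take_iff_getElem.1 hx
    exact h _ _ (by omega)
  rw [h1, List.length_take, min_eq_left hn]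
  omega

section Generic

variable {a : ℂ[T;T⁻¹]} {z : ℂ}

lemma getElem_rootModuli_le {i j : ℕ} (hij : i ≤ j) (hj : j < (rootModuli a z).length) :
    (rootModuli a z)[j] ≤ (rootModuli a z)[i] := by
  rcases hij.eq_or_lt with rfl | h
  · exact le_rfl
  · have hp : (rootModuli a z).Pairwise fun x y => y ≤ x := Multiset.pairwise_sort _ _
    exact List.pairwise_iff_getElem.1 hp i j (hij.trans_lt hj) hj h

lemma IsGeneric.coe_rootModuli (hz : IsGeneric a z) :
    (rootModuli a z : Multiset ℝ≥0∞) =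
      (shiftedPoly a z).roots.map fun w => ENNReal.ofReal ‖w‖ := by
  rw [rootModuli, Multiset.sort_eq, hz.card_roots, add_comm (degMinus a), Nat.sub_self,
    Multiset.replicate_zero, add_zero]

lemma IsGeneric.length_rootModuli (hz : IsGeneric a z) :
    (rootModuli a z).length = degMinus a + degPlus a := by
  rw [← Multiset.coe_card, hz.coe_rootModuli, Multiset.card_map, hz.card_roots]

lemma IsGeneric.countP_rootModuli (hz : IsGeneric a z) (p : ℝ≥0∞ → Prop) [DecidablePred p] :
    (rootModuli a z).countP p =
      (shiftedPoly a z).roots.countP fun w => p (ENNReal.ofReal ‖w‖) := by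
  rw [← Multiset.coe_countP, hz.coe_rootModuli, Multiset.countP_map,
    Multiset.countP_eq_card_filter]

lemma IsGeneric.mem_rootModuli (hz : IsGeneric a z) {x : ℝ≥0∞} :
    x ∈ rootModuli a z ↔ ∃ w, (shiftedPoly a z).eval w = 0 ∧ ENNReal.ofReal ‖w‖ = x := by
  rw [← Multiset.mem_coe, hz.coe_rootModuli, Multiset.mem_map]
  simp only [mem_roots hz.ne_zero, IsRoot.def]

lemma zetaAbs_succ (j : ℕ) : zetaAbs a z (j + 1) = (rootModuli a z).getD j 0 := by
  simp [zetaAbs]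

lemma zetaAbs_zero : zetaAbs a z 0 = ⊤ := by
  simp [zetaAbs]

/-- For generic `z` the `degPlus a`-th and the next root modulus differ. -/
lemma IsGeneric.zetaAbs_lt (hz : IsGeneric a z) :
    zetaAbs a z (degPlus a + 1) < zetaAbs a z (degPlus a) := by
  have hlen := hz.length_rootModuli
  have hfin : ∀ j, (rootModuli a z).getD j 0 < ⊤ := fun j => by
    rcases lt_or_ge j (rootModuli a z).length with hj | hj
    · rw [List.getD_eq_getElem _ _ hj]
      obtain ⟨w, -, hw⟩ := hz.mem_rootModuli.1 (List.getElem_mem hj)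
      rw [← hw]
      exact ENNReal.ofReal_lt_top
    · rw [List.getD_eq_default _ _ hj]
      exact ENNReal.zero_lt_top
  rw [zetaAbs_succ]
  -- At the ends of the list the conventions `∞` and `0` for the missing moduli apply.
  rcases Nat.eq_zero_or_pos (degPlus a) with hn | hn
  · rw [hn, zetaAbs_zero]
    exact hfin 0
  obtain ⟨n, hn'⟩ : ∃ n, degPlus a = n + 1 := ⟨degPlus a - 1, by omega⟩
  have hnlen : n < (rootModuli a z).length := by omega
  rw [hn', zetaAbs_succ, List.getD_eq_getElem _ _ hnlen]
  rcases Nat.eq_zero_or_pos (degMinus a) with hm | hm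
  · rw [List.getD_eq_default _ _ (by omega)]
    obtain ⟨w, hw, hw'⟩ := hz.mem_rootModuli.1 (List.getElem_mem hnlen)
    rw [← hw', ENNReal.ofReal_pos]
    exact norm_pos_iff.2 (hz.root_ne_zero hw)
  have hn1len : n + 1 < (rootModuli a z).length := by omega
  rw [List.getD_eq_getElem _ _ hn1len]
  -- Otherwise fewer than `degPlus a` roots have modulus above that of `u`, but more than
  -- `degPlus a` have at least that modulus.
  by_contra! hle
  obtain ⟨u, hu, hu'⟩ := hz.mem_rootModuli.1 (List.getElem_mem hn1len)
  refine hz.not_countP_straddle ‖u‖ ?_ ?_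
  · have h := countP_le_of_forall_ge (L := rootModuli a z)
      (p := fun x => decide (ENNReal.ofReal ‖u‖ < x)) (n := n) (fun i hi hni => by
        simp only [decide_eq_true_eq, not_lt, hu']
        exact (getElem_rootModuli_le hni hi).trans hle)
    rw [hz.countP_rootModuli] at h
    simp only [ENNReal.ofReal_lt_ofReal_iff_of_nonneg (norm_nonneg u)] at h
    omega
  · have h := le_countP_of_forall_lt (L := rootModuli a z)
      (p := fun x => decide (ENNReal.ofReal ‖u‖ ≤ x)) (n := n + 2) (by omega) (fun i hi hni => by
        simp only [decide_eq_true_eq, hu']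
        exact getElem_rootModuli_le (by omega) hn1len)
    rw [hz.countP_rootModuli] at h
    simp only [ENNReal.ofReal_le_ofReal_iff (norm_nonneg _)] at h
    omega

lemma IsGeneric.radii_nonempty (hz : IsGeneric a z) : (radii a z).Nonempty := by
  obtain ⟨ϱ, h1, h2⟩ := ENNReal.lt_iff_exists_nnreal_btwn.1 hz.zetaAbs_lt
  have hpos : (0 : ℝ≥0∞) < ϱ := zero_le.trans_lt h1
  refine ⟨ϱ, by exact_mod_cast hpos, ?_, ?_⟩
  · rwa [ENNReal.ofReal_coe_nnreal]
  · rwa [ENNReal.ofReal_coe_nnreal]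

/-- A radius in `radii a z` separates the roots into `degMinus a` small and `degPlus a` large
ones. -/
lemma IsGeneric.exists_split_roots (hz : IsGeneric a z) {ϱ : ℝ} (hϱ : ϱ ∈ radii a z) :
    ∃ (s : Fin (degMinus a) → ℂ) (l : Fin (degPlus a) → ℂ), Function.Injective s ∧
      Function.Injective l ∧ (∀ j, (shiftedPoly a z).eval (s j) = 0) ∧
      (∀ j, (shiftedPoly a z).eval (l j) = 0) ∧ (∀ j, ‖s j‖ < ϱ) ∧ (∀ j, ϱ < ‖l j‖) ∧
      ∀ f : ℂ → ℂ, ((shiftedPoly a z).roots.map f).prod = (∏ j, f (s j)) * ∏ j, f (l j) := by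
  classical
  obtain ⟨hϱ0, h1, h2⟩ := hϱ
  have hlen := hz.length_rootModuli
  rw [zetaAbs_succ] at h1
  have hhigh : ∀ (i : ℕ) (hi : i < (rootModuli a z).length), i < degPlus a →
      ENNReal.ofReal ϱ < (rootModuli a z)[i] := fun i hi hin => by
    obtain ⟨n, hn⟩ : ∃ n, degPlus a = n + 1 := ⟨degPlus a - 1, by omega⟩
    have hnlen : n < (rootModuli a z).length := by omega
    rw [hn, zetaAbs_succ, List.getD_eq_getElem _ _ hnlen] at h2
    exact h2.trans_le (getElem_rootModuli_le (by omega) hnlen)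
  have hlow : ∀ (i : ℕ) (hi : i < (rootModuli a z).length), degPlus a ≤ i →
      (rootModuli a z)[i] < ENNReal.ofReal ϱ := fun i hi hin => by
    rw [List.getD_eq_getElem _ _ (hin.trans_lt hi)] at h1
    exact (getElem_rootModuli_le hin hi).trans_lt h1
  set F := (shiftedPoly a z).roots.toFinset with hF
  have hFval : F.val = (shiftedPoly a z).roots := by
    rw [hF, Multiset.toFinset_val, hz.nodup_roots.dedup]
  have hmem : ∀ w, w ∈ F ↔ (shiftedPoly a z).eval w = 0 := fun w => by
    rw [hF, Multiset.mem_toFinset, mem_roots hz.ne_zero, IsRoot.def]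
  have hl : (F.filter fun w => ϱ < ‖w‖).card = degPlus a := by
    have hcount : (rootModuli a z).countP (fun x => ENNReal.ofReal ϱ < x) = degPlus a := by
      refine le_antisymm (countP_le_of_forall_ge fun i hi hni => ?_)
        (le_countP_of_forall_lt (by omega) fun i hi hni => ?_)
      · simpa using (hlow i hi hni).le
      · simpa using hhigh i hi hni
    rw [hz.countP_rootModuli, ← hFval, Multiset.countP_eq_card_filter] at hcount
    simpa only [Finset.card_def, Finset.filter_val,
      ENNReal.ofReal_lt_ofReal_iff_of_nonneg hϱ0.le] using hcount
  have hs : (F.filter fun w => ¬ ϱ < ‖w‖).card = degMinus a := by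
    have h3 := Finset.card_filter_add_card_filter_not (s := F) fun w => ϱ < ‖w‖
    have h4 : F.card = degMinus a + degPlus a := by
      rw [Finset.card_def, hFval, hz.card_roots]
    omega
  set es := (Finset.equivFinOfCardEq hs).symm with hes
  set el := (Finset.equivFinOfCardEq hl).symm with hel
  have hsm := fun j => Finset.mem_filter.1 (es j).2
  have hlm := fun j => Finset.mem_filter.1 (el j).2
  refine ⟨fun j => es j, fun j => el j, Subtype.val_injective.comp es.injective,
    Subtype.val_injective.comp el.injective, fun j => (hmem _).1 (hsm j).1,
    fun j => (hmem _).1 (hlm j).1, fun j => ?_, fun j => (hlm j).2, fun f => ?_⟩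
  · have hroot := (hmem _).1 (hsm j).1
    have hx := hz.mem_rootModuli.2 ⟨_, hroot, rfl⟩
    obtain ⟨i, hi, hix⟩ := List.getElem_of_mem hx
    rcases lt_or_ge i (degPlus a) with hin | hin
    · have := hhigh i hi hin
      rw [hix, ENNReal.ofReal_lt_ofReal_iff_of_nonneg hϱ0.le] at this
      exact absurd this (hsm j).2
    · have := hlow i hi hin
      rwa [hix, ENNReal.ofReal_lt_ofReal_iff hϱ0] at this
  · have h5 : ((shiftedPoly a z).roots.map f).prod = ∏ w ∈ F, f w := by
      rw [Finset.prod, hFval]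
    rw [h5, ← Finset.prod_filter_not_mul_prod_filter F (fun w => ϱ < ‖w‖)]
    congr 1
    · rw [← Finset.prod_coe_sort]
      exact (es.prod_comp fun w => f w).symm
    · rw [← Finset.prod_coe_sort]
      exact (el.prod_comp fun w => f w).symm

/-- Jensen's formula on the circle of radius `ϱ`. -/
lemma circleAverage_log_symbol (hz : IsGeneric a z) {ϱ : ℝ} (hϱ : 0 < ϱ)
    {s : Fin (degMinus a) → ℂ} {l : Fin (degPlus a) → ℂ} (hs : ∀ j, ‖s j‖ < ϱ)
    (hl : ∀ j, ϱ < ‖l j‖)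
    (hprod : ∀ f : ℂ → ℂ,
      ((shiftedPoly a z).roots.map f).prod = (∏ j, f (s j)) * ∏ j, f (l j)) :
    Real.circleAverage (fun w => Real.log ‖symbol a w - z‖) 0 ϱ =
      Real.log ‖(shiftedPoly a z).coeff (degMinus a + degPlus a)‖ +
        ∑ j, Real.log ‖l j‖ := by
  set p := (shiftedPoly a z).coeff (degMinus a + degPlus a) with hp
  have hp0 : p ≠ 0 := hz.coeff_top_ne_zero
  have hlc : (shiftedPoly a z).leadingCoeff = p := by rw [leadingCoeff, hz.natDegree_eq]
  have hint : ∀ u : ℂ, CircleIntegrable (fun w => Real.log ‖w - u‖) 0 ϱ :=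
    fun u => circleIntegrable_log_norm_sub_const ϱ
  -- On the circle `a(w) - z = p ∏ (w - sⱼ) ∏ (w - lⱼ) / w ^ m`.
  have heq : Set.EqOn (fun w => Real.log ‖symbol a w - z‖)
      (fun w => (∑ j, Real.log ‖w - s j‖ + ∑ j, Real.log ‖w - l j‖) +
        (Real.log ‖p‖ - degMinus a * Real.log ϱ)) (Metric.sphere 0 |ϱ|) := by
    intro w hw
    have hw' : ‖w‖ = ϱ := by simpa [abs_of_pos hϱ] using hw
    have hw0 : w ≠ 0 := by rw [← norm_pos_iff, hw']; exact hϱ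
    have hws : ∀ j, ‖w - s j‖ ≠ 0 := fun j => norm_ne_zero_iff.2 (sub_ne_zero.2 fun h => by
      have := hs j
      rw [← h, hw'] at this
      exact lt_irrefl _ this)
    have hwl : ∀ j, ‖w - l j‖ ≠ 0 := fun j => norm_ne_zero_iff.2 (sub_ne_zero.2 fun h => by
      have := hl j
      rw [← h, hw'] at this
      exact lt_irrefl _ this)
    have h1 := eval_shiftedPoly a z hw0
    rw [(IsAlgClosed.splits _).eval_eq_prod_roots, hlc, hprod] at h1
    have h2 : ‖symbol a w - z‖ =
        ‖p‖ * ((∏ j, ‖w - s j‖) * ∏ j, ‖w - l j‖) / ϱ ^ degMinus a := by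
      rw [eq_div_iff (pow_pos hϱ _).ne', ← norm_prod, ← norm_prod, ← norm_mul, ← norm_mul, h1,
        norm_mul, norm_pow, hw', mul_comm]
    simp only
    rw [h2, Real.log_div, Real.log_mul (norm_ne_zero_iff.2 hp0), Real.log_mul, Real.log_pow,
      Real.log_prod fun j _ => hws j, Real.log_prod fun j _ => hwl j]
    · ring
    · exact Finset.prod_ne_zero_iff.2 fun j _ => hws j
    · exact Finset.prod_ne_zero_iff.2 fun j _ => hwl j
    · exact mul_ne_zero (Finset.prod_ne_zero_iff.2 fun j _ => hws j)
        (Finset.prod_ne_zero_iff.2 fun j _ => hwl j)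
    · exact mul_ne_zero (norm_ne_zero_iff.2 hp0)
        (mul_ne_zero (Finset.prod_ne_zero_iff.2 fun j _ => hws j)
          (Finset.prod_ne_zero_iff.2 fun j _ => hwl j))
    · exact (pow_pos hϱ _).ne'
  -- The mean of `log |w - u|` over the circle is `log (max ϱ |u|)`.
  have havs : ∀ j, Real.circleAverage (fun w => Real.log ‖w - s j‖) 0 ϱ = Real.log ϱ := fun j =>
    circleAverage_log_norm_sub_const_of_mem_closedBall (by
      simpa [abs_of_pos hϱ] using (hs j).le)
  have havl : ∀ j, Real.circleAverage (fun w => Real.log ‖w - l j‖) 0 ϱ = Real.log ‖l j‖ :=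
    fun j => by
    rw [circleAverage_log_norm_sub_const_eq_log_radius_add_posLog hϱ.ne', zero_sub, norm_neg,
      Real.posLog_eq_log, Real.log_mul (inv_ne_zero hϱ.ne') (hϱ.trans (hl j)).ne', Real.log_inv]
    · ring
    · rw [abs_of_nonneg (by positivity), ← div_eq_inv_mul, one_le_div hϱ]
      exact (hl j).le
  have hsum1 : CircleIntegrable (fun w => ∑ j, Real.log ‖w - s j‖) 0 ϱ := by
    have := CircleIntegrable.sum Finset.univ fun j (_ : j ∈ Finset.univ) => hint (s j)
    convert this using 1
    ext w; simp
  have hsum2 : CircleIntegrable (fun w => ∑ j, Real.log ‖w - l j‖) 0 ϱ := by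
    have := CircleIntegrable.sum Finset.univ fun j (_ : j ∈ Finset.univ) => hint (l j)
    convert this using 1
    ext w; simp
  have hsum : CircleIntegrable
      (fun w => ∑ j, Real.log ‖w - s j‖ + ∑ j, Real.log ‖w - l j‖) 0 ϱ := hsum1.add hsum2
  rw [Real.circleAverage_congr_sphere heq,
    Real.circleAverage_fun_add hsum (circleIntegrable_const _ _ _),
    Real.circleAverage_fun_add hsum1 hsum2, Real.circleAverage_const,
    Real.circleAverage_fun_sum fun j _ => hint _, Real.circleAverage_fun_sum fun j _ => hint _]
  simp only [havs, havl, Finset.sum_const, Finset.card_univ, Fintype.card_fin, nsmul_eq_mul]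
  ring

lemma logPot_eq_circleAverage (h : (radii a z).Nonempty) :
    logPot a z = Real.circleAverage (fun w => Real.log ‖symbol a w - z‖) 0 h.some := by
  rw [logPot, dif_pos h, Real.circleAverage_def, smul_eq_mul]
  simp only [circleMap, zero_add, mul_comm Complex.I]

open Matrix in
/-- The shifted Toeplitz matrix has `a_{i-j}` at `(i, j)`, while the rows of a band matrix run
through shifted coefficients with `p_{m+j-i}`; hence the transpose. -/
lemma transpose_bandMatrix_shiftedPoly (N : ℕ) :
    (bandMatrix (shiftedPoly a z) (degMinus a) N)ᵀ = toeplitz a N - scalar (Fin N) z := by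
  ext i j
  simp only [transpose_apply, bandMatrix, toeplitz, Matrix.of_apply, Matrix.sub_apply,
    coeff_mul_X_pow', coeff_shiftedPoly, scalar_apply, diagonal_apply]
  by_cases hij : i = j
  · subst hij
    simp
  · have hij' : (i : ℕ) ≠ j := fun h => hij (Fin.ext h)
    rw [if_neg hij]
    split_ifs with h1 h2
    · omega
    · rw [Nat.cast_sub h1]
      congr 2
      push_cast
      ring
    · rw [coeff_eq_zero_of_lt_degMinus (by omega), sub_zero]

open Matrix in
/-- The potentials of the unperturbed Toeplitz matrices converge at every generic value. -/
theorem IsGeneric.tendsto_log_norm_det (hz : IsGeneric a z) :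
    Tendsto (fun N : ℕ => (N : ℝ)⁻¹ * Real.log ‖(toeplitz a N - scalar (Fin N) z).det‖) atTop
      (𝓝 (logPot a z)) ∧
    ∀ᶠ N : ℕ in atTop, (toeplitz a N - scalar (Fin N) z).det ≠ 0 := by
  have hne := hz.radii_nonempty
  have hϱ := hne.some_mem
  obtain ⟨s, l, hs, hl, hs0, hl0, hsϱ, hlϱ, hprod⟩ := hz.exists_split_roots hϱ
  have h := tendsto_log_norm_det_bandMatrix (natDegree_shiftedPoly_le a z) hz.coeff_top_ne_zero
    hs0 hl0 hs hl hϱ.1 hsϱ hlϱ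
  rw [← circleAverage_log_symbol hz hϱ.1 hsϱ hlϱ hprod, ← logPot_eq_circleAverage hne] at h
  simp only [← det_transpose (bandMatrix _ _ _), transpose_bandMatrix_shiftedPoly] at h
  exact h

end Generic

end

/-! ### Spectral measures of perturbed Toeplitz matrices -/

section

open Matrix

/-- The `ℓ¹` norm of the coefficients of a Laurent polynomial. -/
def coeffSum (a : ℂ[T;T⁻¹]) : ℝ := ∑ k ∈ a.coeff.support, ‖a.coeff k‖

lemma sum_norm_toeplitz_le (a : ℂ[T;T⁻¹]) (N : ℕ) (i : Fin N) :
    ∑ j, ‖toeplitz a N i j‖ ≤ coeffSum a := by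
  classical
  have hinj : Set.InjOn (fun j : Fin N => ((i : ℕ) : ℤ) - ((j : ℕ) : ℤ))
      (Finset.univ : Finset (Fin N)) := fun j _ j' _ h => Fin.ext (by
    simp only at h; omega)
  have h1 : ∑ j, ‖toeplitz a N i j‖ = ∑ k ∈ Finset.univ.image
      (fun j : Fin N => ((i : ℕ) : ℤ) - ((j : ℕ) : ℤ)), ‖a.coeff k‖ := by
    rw [Finset.sum_image hinj]
    rfl
  rw [h1, coeffSum]
  calc _ ≤ ∑ k ∈ Finset.univ.image (fun j : Fin N => ((i : ℕ) : ℤ) - ((j : ℕ) : ℤ)) ∪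
        a.coeff.support, ‖a.coeff k‖ :=
        Finset.sum_le_sum_of_subset_of_nonneg Finset.subset_union_left
          fun _ _ _ => norm_nonneg _
    _ = _ := by
        refine (Finset.sum_subset Finset.subset_union_right fun k _ hk => ?_).symm
        rw [Finsupp.notMem_support_iff.1 hk, norm_zero]

lemma sum_norm_toeplitz_sub_scalar_le (a : ℂ[T;T⁻¹]) (z : ℂ) (N : ℕ) (i : Fin N) :
    ∑ j, ‖(toeplitz a N - scalar (Fin N) z) i j‖ ≤ coeffSum a + ‖z‖ := by
  calc _ ≤ ∑ j, (‖toeplitz a N i j‖ + ‖scalar (Fin N) z i j‖) :=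
        Finset.sum_le_sum fun j _ => norm_sub_le _ _
    _ = ∑ j, ‖toeplitz a N i j‖ + ∑ j, ‖scalar (Fin N) z i j‖ := Finset.sum_add_distrib
    _ ≤ coeffSum a + ‖z‖ := by
        refine add_le_add (sum_norm_toeplitz_le a N i) (le_of_eq ?_)
        rw [Finset.sum_eq_single i] <;> simp +contextual [eq_comm]

section Deterministic

variable {a : ℂ[T;T⁻¹]} {B : ∀ N : ℕ, Matrix (Fin N) (Fin N) ℂ} {η : ℕ → ℝ}

/-- The potentials of the perturbed Toeplitz matrices converge almost everywhere. -/
lemma ae_tendsto_logAvg (hB : ∀ᶠ N in atTop, ∀ i j, ‖B N i j‖ ≤ η N)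
    (hη : ∀ c : ℝ, ∀ᶠ N : ℕ in atTop, (N : ℝ) ^ 2 * η N ≤ Real.exp (-(c * N))) :
    ∀ᵐ z, Tendsto (fun N => logAvg N (toeplitz a N + B N).charpoly.roots z) atTop
      (𝓝 (logPot a z)) := by
  filter_upwards [ae_isGeneric a] with z hz
  obtain ⟨h1, h2⟩ := hz.tendsto_log_norm_det
  obtain ⟨h3, h4⟩ := tendsto_log_norm_det_add
    (fun N i => sum_norm_toeplitz_sub_scalar_le a z N i) hB hη h1 h2
  refine h3.congr' ?_
  filter_upwards [h4] with N hN
  have he : toeplitz a N - scalar (Fin N) z + B N = toeplitz a N + B N - scalar (Fin N) z := by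
    abel
  rw [he] at hN ⊢
  rw [logAvg_roots_charpoly _ hN]

lemma eventually_norm_roots_le (hB : ∀ᶠ N in atTop, ∀ i j, ‖B N i j‖ ≤ η N)
    (hη : ∀ c : ℝ, ∀ᶠ N : ℕ in atTop, (N : ℝ) ^ 2 * η N ≤ Real.exp (-(c * N))) :
    ∀ᶠ N in atTop, ∀ w ∈ (toeplitz a N + B N).charpoly.roots, ‖w‖ ≤ coeffSum a + 1 := by
  filter_upwards [hB, hη 0, eventually_gt_atTop 0] with N h1 h2 h3 w hw
  have hN : (1 : ℝ) ≤ N := by exact_mod_cast h3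
  have hη0 : 0 ≤ η N := (norm_nonneg _).trans (h1 ⟨0, h3⟩ ⟨0, h3⟩)
  simp only [zero_mul, neg_zero, Real.exp_zero] at h2
  refine norm_le_of_mem_roots_charpoly (fun i => ?_) hw
  calc _ ≤ ∑ j, (‖toeplitz a N i j‖ + η N) :=
        Finset.sum_le_sum fun j _ => (norm_add_le _ _).trans (by gcongr; exact h1 i j)
    _ = ∑ j, ‖toeplitz a N i j‖ + N * η N := by simp [Finset.sum_add_distrib]
    _ ≤ coeffSum a + 1 := by
        refine add_le_add (sum_norm_toeplitz_le a N i) ?_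
        nlinarith [mul_nonneg (by linarith : (0:ℝ) ≤ N) hη0]

/-- The deterministic form of the theorem, for perturbations with super-exponentially small entries.
-/
theorem tendsto_integral_empMeasure (hB : ∀ᶠ N in atTop, ∀ i j, ‖B N i j‖ ≤ η N)
    (hη : ∀ c : ℝ, ∀ᶠ N : ℕ in atTop, (N : ℝ) ^ 2 * η N ≤ Real.exp (-(c * N)))
    {μ : Measure ℂ} [IsProbabilityMeasure μ] (hμR : μ (Metric.closedBall 0 (coeffSum a + 1))ᶜ = 0)
    (hμ : IsDistribLaplacian μ (logPot a)) (f : ℂ →ᵇ ℝ) :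
    Tendsto (fun N => ∫ z, f z ∂(empMeasure (toeplitz a N + B N))) atTop (𝓝 (∫ z, f z ∂μ)) :=
  tendsto_integral_avgDirac (Eventually.of_forall fun _ => card_roots_charpoly _)
    (eventually_norm_roots_le hB hη) (ae_tendsto_logAvg hB hη) hμR hμ f

end Deterministic

/-- The limit measure is obtained from the unperturbed matrices; it lives on a disc that contains
the eigenvalues of all small perturbations. -/
theorem exists_limit_measure (a : ℂ[T;T⁻¹]) :
    ∃ μ : Measure ℂ, IsProbabilityMeasure μ ∧ μ (Metric.closedBall 0 (coeffSum a + 1))ᶜ = 0 ∧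
      IsDistribLaplacian μ (logPot a) := by
  have hB : ∀ᶠ N : ℕ in atTop, ∀ i j, ‖(0 : Matrix (Fin N) (Fin N) ℂ) i j‖ ≤ (0 : ℝ) :=
    Eventually.of_forall fun N i j => by simp
  have hη : ∀ c : ℝ, ∀ᶠ N : ℕ in atTop, (N : ℝ) ^ 2 * (0 : ℝ) ≤ Real.exp (-(c * N)) :=
    fun c => Eventually.of_forall fun N => by rw [mul_zero]; positivity
  exact exists_isDistribLaplacian
    (Eventually.of_forall fun N => card_roots_charpoly (toeplitz a N + 0))
    (eventually_norm_roots_le (η := fun _ => 0) hB hη) (ae_tendsto_logAvg (η := fun _ => 0) hB hη)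

/-- A super-exponentially small sequence remains so after multiplication by a power of `N`. -/
lemma eventually_pow_mul_le_exp {δ : ℕ → ℝ} (hδ_pos : ∀ N, 0 < δ N)
    (hδ : Tendsto (fun N : ℕ => (N : ℝ)⁻¹ * Real.log (1 / δ N)) atTop atTop) (k : ℕ) (c : ℝ) :
    ∀ᶠ N : ℕ in atTop, (N : ℝ) ^ k * δ N ≤ Real.exp (-(c * N)) := by
  have h0 : Tendsto (fun N : ℕ => (N : ℝ) ^ k * Real.exp (-(N : ℝ))) atTop (𝓝 0) :=
    (Real.tendsto_pow_mul_exp_neg_atTop_nhds_zero k).comp tendsto_natCast_atTop_atTop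
  filter_upwards [hδ.eventually_ge_atTop (c + 1), eventually_gt_atTop 0,
    h0.eventually (ge_mem_nhds one_pos)] with N h1 h2 h3
  have hN : (0 : ℝ) < N := by exact_mod_cast h2
  rw [le_inv_mul_iff₀ hN, one_div, Real.log_inv, le_neg, Real.log_le_iff_le_exp (hδ_pos N)] at h1
  calc (N : ℝ) ^ k * δ N ≤ (N : ℝ) ^ k * Real.exp (-(N * (c + 1))) := by gcongr
    _ = (N : ℝ) ^ k * Real.exp (-(N : ℝ)) * Real.exp (-(c * N)) := by
        rw [mul_assoc, ← Real.exp_add]; congr 2; ring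
    _ ≤ 1 * Real.exp (-(c * N)) := by gcongr
    _ = _ := one_mul _

lemma norm_apply_le_of_hsNormSq_le {N : ℕ} {A : Matrix (Fin N) (Fin N) ℂ} {K : ℝ} (hK : 0 ≤ K)
    (h : hsNormSq A ≤ K ^ 2) (i j : Fin N) : ‖A i j‖ ≤ K := by
  have h1 : ‖A i j‖ ^ 2 ≤ hsNormSq A :=
    (Finset.single_le_sum (f := fun j => ‖A i j‖ ^ 2) (fun _ _ => by positivity)
      (Finset.mem_univ j)).trans
      (Finset.single_le_sum (f := fun i => ∑ j, ‖A i j‖ ^ 2)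
        (fun _ _ => Finset.sum_nonneg fun _ _ => by positivity) (Finset.mem_univ i))
  exact (sq_le_sq₀ (norm_nonneg _) hK).1 (h1.trans h)

/-- By Markov's inequality `‖E_N‖_HS ≤ N²` with probability tending to `1`. -/
lemma tendsto_measure_hsNormSq_gt {Ω : ℕ → Type*} [∀ N, MeasurableSpace (Ω N)]
    (P : ∀ N, Measure (Ω N)) (E : ∀ N, Ω N → Matrix (Fin N) (Fin N) ℂ)
    (hE_meas : ∀ N i j, Measurable fun ω => E N ω i j)
    (hE_hs : ∃ C : ℝ≥0, ∀ᶠ N : ℕ in atTop,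
      ∫⁻ ω, ENNReal.ofReal (hsNormSq (E N ω)) ∂(P N) ≤ C * (N : ℝ≥0∞) ^ 2) :
    Tendsto (fun N : ℕ => P N {ω | ((N : ℝ) ^ 2) ^ 2 < hsNormSq (E N ω)}) atTop (𝓝 0) := by
  obtain ⟨C, hC⟩ := hE_hs
  have h0 : Tendsto (fun N : ℕ => (C : ℝ≥0∞) * (N : ℝ≥0∞)⁻¹) atTop (𝓝 0) := by
    simpa using ENNReal.Tendsto.const_mul ENNReal.tendsto_inv_nat_nhds_zero
      (Or.inr (ENNReal.coe_ne_top (r := C)))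
  refine tendsto_of_tendsto_of_tendsto_of_le_of_le' tendsto_const_nhds h0
    (Eventually.of_forall fun _ => zero_le) ?_
  filter_upwards [hC, eventually_gt_atTop 0] with N h1 h2
  have hmeas : Measurable fun ω => ENNReal.ofReal (hsNormSq (E N ω)) := by
    unfold hsNormSq
    refine ENNReal.measurable_ofReal.comp (Finset.measurable_fun_sum _ fun i _ =>
      Finset.measurable_fun_sum _ fun j _ => ((hE_meas N i j).norm.pow_const 2))
  have hN0 : (N : ℝ≥0∞) ≠ 0 := by exact_mod_cast h2.ne'
  have hN4 : ((N : ℝ≥0∞) ^ 4) ≠ 0 := pow_ne_zero _ hN0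
  have hNt : ((N : ℝ≥0∞) ^ 4) ≠ ⊤ := ENNReal.pow_ne_top (ENNReal.natCast_ne_top N)
  calc P N {ω | ((N : ℝ) ^ 2) ^ 2 < hsNormSq (E N ω)}
      ≤ P N {ω | (N : ℝ≥0∞) ^ 4 ≤ ENNReal.ofReal (hsNormSq (E N ω))} := by
        refine measure_mono fun ω hω => ?_
        have hω' : ((N : ℝ) ^ 2) ^ 2 < hsNormSq (E N ω) := hω
        show (N : ℝ≥0∞) ^ 4 ≤ ENNReal.ofReal (hsNormSq (E N ω))
        calc (N : ℝ≥0∞) ^ 4 = ENNReal.ofReal (((N : ℝ) ^ 2) ^ 2) := by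
              rw [← pow_mul, ENNReal.ofReal_pow (by positivity), ENNReal.ofReal_natCast]
          _ ≤ _ := ENNReal.ofReal_le_ofReal hω'.le
    _ ≤ (∫⁻ ω, ENNReal.ofReal (hsNormSq (E N ω)) ∂(P N)) / (N : ℝ≥0∞) ^ 4 :=
        meas_ge_le_lintegral_div hmeas.aemeasurable hN4 hNt
    _ ≤ C * (N : ℝ≥0∞) ^ 2 / (N : ℝ≥0∞) ^ 4 := by gcongr
    _ ≤ C * (N : ℝ≥0∞)⁻¹ := by
        refine ENNReal.div_le_of_le_mul ?_
        have : (N : ℝ≥0∞)⁻¹ * (N : ℝ≥0∞) ^ 4 = (N : ℝ≥0∞) ^ 3 := by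
          rw [pow_succ' (N : ℝ≥0∞) 3, ← mul_assoc,
            ENNReal.inv_mul_cancel hN0 (ENNReal.natCast_ne_top N), one_mul]
        rw [mul_assoc, this]
        gcongr
        · exact_mod_cast h2
        · norm_num

end

end ToeplitzLSD

end

theorem theorem2p4 (a : ℂ[T;T⁻¹])
    {Ω : ℕ → Type*} [∀ N, MeasurableSpace (Ω N)]
    (P : ∀ N, Measure (Ω N)) [∀ N, IsProbabilityMeasure (P N)]
    (E : ∀ N, Ω N → Matrix (Fin N) (Fin N) ℂ)
    (hE_meas : ∀ N i j, Measurable fun ω => E N ω i j)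
    (hE_hs : ∃ C : ℝ≥0, ∀ᶠ N : ℕ in atTop,
      ∫⁻ ω, ENNReal.ofReal (ToeplitzLSD.hsNormSq (E N ω)) ∂(P N) ≤ C * (N : ℝ≥0∞) ^ 2)
    (δ : ℕ → ℝ) (hδ_pos : ∀ N, 0 < δ N)
    (hδ : Tendsto (fun N : ℕ => (N : ℝ)⁻¹ * Real.log (1 / δ N)) atTop atTop) :
    ∃ μ : Measure ℂ, IsProbabilityMeasure μ ∧
      ToeplitzLSD.IsDistribLaplacian μ (ToeplitzLSD.logPot a) ∧
      ToeplitzLSD.ConvWeakly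
        (fun N => ToeplitzLSD.empMeasure (ToeplitzLSD.toeplitz a N)) μ ∧
      ToeplitzLSD.ConvWeaklyInProb P
        (fun N ω => ToeplitzLSD.empMeasure
          (ToeplitzLSD.toeplitz a N + (δ N : ℂ) • E N ω)) μ := by
  classical
  obtain ⟨μ, hμp, hμR, hμ⟩ := ToeplitzLSD.exists_limit_measure a
  have hη : ∀ c : ℝ, ∀ᶠ N : ℕ in atTop,
      (N : ℝ) ^ 2 * ((N : ℝ) ^ 2 * δ N) ≤ Real.exp (-(c * N)) := fun c => by
    filter_upwards [ToeplitzLSD.eventually_pow_mul_le_exp hδ_pos hδ 4 c] with N hN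
    rwa [← mul_assoc, ← pow_add]
  have hη0 : ∀ N : ℕ, 0 ≤ (N : ℝ) ^ 2 * δ N := fun N => by
    have := hδ_pos N
    positivity
  refine ⟨μ, hμp, hμ, fun f => ?_, fun f ε hε => ?_⟩
  · have h := ToeplitzLSD.tendsto_integral_empMeasure (a := a) (B := fun _ => 0)
      (Eventually.of_forall fun N i j => by simpa using hη0 N) hη hμR hμ f
    simpa using h
  · -- On the event `‖E‖² ≤ N⁴` the perturbation is deterministically small. If the spectral
    -- measure were far from `μ` somewhere on that event for infinitely many `N`, then picking such
    -- samples would contradict the deterministic statement.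
    set Bad : ∀ N, Ω N → Prop := fun N ω =>
      ToeplitzLSD.hsNormSq (E N ω) ≤ ((N : ℝ) ^ 2) ^ 2 ∧
        ε ≤ |∫ z, f z ∂(ToeplitzLSD.empMeasure (ToeplitzLSD.toeplitz a N + (δ N : ℂ) • E N ω)) -
          ∫ z, f z ∂μ| with hBad
    set B : ∀ N : ℕ, Matrix (Fin N) (Fin N) ℂ := fun N =>
      if h : ∃ ω, Bad N ω then (δ N : ℂ) • E N h.choose else 0 with hBdef
    have hBle : ∀ N i j, ‖B N i j‖ ≤ (N : ℝ) ^ 2 * δ N := fun N i j => by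
      by_cases h : ∃ ω, Bad N ω
      · have h1 := ToeplitzLSD.norm_apply_le_of_hsNormSq_le (by positivity) h.choose_spec.1 i j
        have h2 : B N = (δ N : ℂ) • E N h.choose := dif_pos h
        rw [h2, Matrix.smul_apply, norm_smul, Complex.norm_real,
          Real.norm_of_nonneg (hδ_pos N).le, mul_comm]
        exact mul_le_mul_of_nonneg_right h1 (hδ_pos N).le
      · have h2 : B N = 0 := dif_neg h
        rw [h2]
        simpa using hη0 N
    have hlim := ToeplitzLSD.tendsto_integral_empMeasure (a := a) (B := B)
      (Eventually.of_forall hBle) hη hμR hμ f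
    have hnone : ∀ᶠ N in atTop, ∀ ω, ¬ Bad N ω := by
      filter_upwards [(Metric.tendsto_nhds.1 hlim) ε hε] with N hN ω hω
      have h : ∃ ω, Bad N ω := ⟨ω, hω⟩
      have h2 : B N = (δ N : ℂ) • E N h.choose := dif_pos h
      rw [h2, Real.dist_eq] at hN
      exact absurd h.choose_spec.2 (not_le.2 hN)
    refine tendsto_of_tendsto_of_tendsto_of_le_of_le' tendsto_const_nhds
      (ToeplitzLSD.tendsto_measure_hsNormSq_gt P E hE_meas hE_hs)
      (Eventually.of_forall fun _ => zero_le) ?_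
    filter_upwards [hnone] with N hN
    refine measure_mono fun ω hω => ?_
    by_contra hle
    exact hN ω ⟨not_lt.1 hle, hω⟩
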